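/- Let $P$ be a finite set of atomic propositions and let $\widetilde\Sigma=(\Sigma_c,\Sigma_r,\Sigma_l)$ be a partition of $2^P$ into calls, returns and local actions (parts may be empty). A *visibly pushdown system* (VPS) $\mathcal S=(Q,\widetilde\Sigma,\Gamma,\Delta)$ has a finite set $Q$ of states, a finite stack alphabet $\Gamma$ containing a bottom marker $\bot$, and a relation $\Delta\subseteq (Q\times\Sigma_c\times Q\times(\Gamma\setminus\{\bot\}))\cup(Q\times\Sigma_r\times\Gamma\times Q)\cup(Q\times\Sigma_l\times Q)$. Its configurations are the pairs $(q,\gamma)$ with $q\in Q$ and $\gamma\in(\Gamma\setminus\{\bot\})^*\bot$ (top of the stack on the left). There is an $a$-labelled edge from $(q,\gamma)$ to $(q',\gamma')$ iff either $a\in\Sigma_c$, $(q,a,q',A)\in\Delta$ and $\gamma'=A\gamma$ for some $A$; or $a\in\Sigma_r$, $(q,a,\bot,q')\in\Delta$ and $\gamma=\gamma'=\bot$; or $a\in\Sigma_r$, $(q,a,A,q')\in\Delta$ and $\gamma=A\gamma'$ for some $A\neq\bot$; or $a\in\Sigma_l$, $(q,a,q')\in\Delta$ and $\gamma=\gamma'$.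 *VLDL formulas* are given by $\varphi::=p\mid\neg\varphi\mid\varphi\wedge\varphi\mid\varphi\vee\varphi\mid\langle\mathfrak A\rangle\varphi\mid[\mathfrak A]\varphi$, where $p\in P$ and $\mathfrak A$ is a testing visibly pushdown automaton, i.e. a VPS over $\widetilde\Sigma$ with sets $I,F$ of initial and final states and a partial map $t$ from its states to (previously constructed) VLDL formulas. For $\alpha\in(2^P)^\omega$ and $k\in\mathbb N$: $(\alpha,k)\models p$ iff $p\in\alpha_k$; Boolean connectives are interpreted as usual; $(\alpha,k)\models\langle\mathfrak A\rangle\varphi$ iff there is $l\ge k$ with $(k,l)\in\mathcal R_{\mathfrak A}(\alpha)$ and $(\alpha,l)\models\varphi$; and $(\alpha,k)\models[\mathfrak A]\varphi$ iff $(\alpha,l)\models\varphi$ for all $l\ge k$ with $(k,l)\in\mathcal R_{\mathfrak A}(\alpha)$. Here $(k,l)\in\mathcal R_{\mathfrak A}(\alpha)$ iff $k\le l$ and there are configurations $(q_k,\sigma_k),\dots,(q_l,\sigma_l)$ of $\mathfrak A$ with $q_k\in I$, $\sigma_k=\bot$, $q_l\in F$, an $\alpha_m$-labelled edge from $(q_m,\sigma_m)$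 to $(q_{m+1},\sigma_{m+1})$ for $k\le m<l$, and $(\alpha,m)\models t(q_m)$ for all $k\le m\le l$ for which $t(q_m)$ is defined. The word $\alpha$ is a model of $\varphi$ if $(\alpha,0)\models\varphi$. A *visibly pushdown game* (VPG) with VLDL winning condition $\mathcal H=(\mathcal S,Q_0,Q_1,q_I,\varphi)$ consists of a VPS $\mathcal S$ over $\widetilde\Sigma$, a partition of its states into $Q_0$ and $Q_1$, a state $q_I$, and a VLDL formula $\varphi$ over $\widetilde\Sigma$. It is played by Players $0$ and $1$ on the vertices $(q,\gamma,a)$ with $(q,\gamma)$ a configuration and $a\in 2^P$; the vertex belongs to Player $i$ if $q\in Q_i$, and its label is $a$. There is an edge from $(q,\gamma,a)$ to $(q',\gamma',a')$ iff $\mathcal S$ has an $a'$-labelled edge from $(q,\gamma)$ to $(q',\gamma')$. The initial vertex is $v_I=(q_I,\bot,a_0)$ for some (arbitrary) $a_0\in 2^P$. An initial play is an infinite path $v_0v_1v_2\cdots$ with $v_0=v_I$. It is winning for Player $0$ if the sequence of the labels of $v_1,v_2,v_3,\dots$ is a model of $\varphi$, and winning for Player $1$ otherwise. With $V$ the set of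 vertices and $V_i$ those of Player $i$, a strategy for Player $i$ is a map $\sigma\colon V^*V_i\to V$ such that $\sigma(wv)$ is a successor of $v$ whenever $v$ has a successor. A play is consistent with $\sigma$ if $\sigma(v_0\cdots v_n)=v_{n+1}$ for all $n$ with $v_n\in V_i$. The strategy is winning if all initial plays consistent with it are winning for Player $i$. **Proposition.** Every visibly pushdown game with a VLDL winning condition is determined: Player $0$ or Player $1$ has a winning strategy. -/

import Mathlib

/-- The three classes of letters of a pushdown alphabet. A pushdown alphabet on a set `A` of
letters, i.e. a partition of `A` into calls, returns and local actions, is a map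
`κ : A → ActionKind` (each part may be empty). -/
inductive ActionKind where
  | call
  | ret
  | loc

/-- A visibly pushdown system with states `Q`. Here `Γ` is the set of stack symbols *other than*
the bottom marker `⊥`; the full stack alphabet is `Option Γ`, where `none` is `⊥`.
The transition relation is split into its three parts; `Edge` uses a transition from one of these
parts only if its letter has the right kind. -/
structure VPS {A : Type*} (κ : A → ActionKind) (Q Γ : Type*) where
  callTrans : Set (Q × A × Q × Γ)
  retTrans : Set (Q × A × Option Γ × Q)
  locTrans : Set (Q × A × Q)

/-- The labelled edges of the configuration graph. A configuration is `(q, γ)` where the list `γ`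
is the stack content from top to bottom, without the bottom marker (so `[]` is the stack `⊥`). -/
inductive VPS.Edge {A : Type*} {κ : A → ActionKind} {Q Γ : Type*} (S : VPS κ Q Γ) :
    Q × List Γ → A → Q × List Γ → Prop where
  | call {q q' : Q} {a : A} {X : Γ} {γ : List Γ} (ha : κ a = ActionKind.call)
      (h : (q, a, q', X) ∈ S.callTrans) : S.Edge (q, γ) a (q', X :: γ)
  | retBot {q q' : Q} {a : A} (ha : κ a = ActionKind.ret)
      (h : (q, a, none, q') ∈ S.retTrans) : S.Edge (q, []) a (q', [])
  | ret {q q' : Q} {a : A} {X : Γ} {γ : List Γ} (ha : κ a = ActionKind.ret)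
      (h : (q, a, some X, q') ∈ S.retTrans) : S.Edge (q, X :: γ) a (q', γ)
  | loc {q q' : Q} {a : A} {γ : List Γ} (ha : κ a = ActionKind.loc)
      (h : (q, a, q') ∈ S.locTrans) : S.Edge (q, γ) a (q', γ)

/-- A visibly pushdown automaton: a visibly pushdown system with initial and final states. -/
structure VPA {A : Type*} (κ : A → ActionKind) (Q Γ : Type*) extends VPS κ Q Γ where
  init : Set Q
  final : Set Q

/-- For a visibly pushdown automaton `𝔄` whose states carry tests (`test q m` says that the test
attached to `q` holds at position `m`), the set of pairs `(k, l)` such that there is an initial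
accepting run `ρ k, …, ρ l` of `𝔄` on `α k, …, α (l - 1)` for which the test attached to the state
of `ρ m` holds at position `m`, for all `m` in `{k, …, l}`. -/
def VPA.matches {A : Type*} {κ : A → ActionKind} {Q Γ : Type*} (𝔄 : VPA κ Q Γ)
    (test : Q → ℕ → Prop) (α : ℕ → A) : Set (ℕ × ℕ) :=
  {kl | kl.1 ≤ kl.2 ∧ ∃ ρ : ℕ → Q × List Γ,
    (ρ kl.1).1 ∈ 𝔄.init ∧ (ρ kl.1).2 = [] ∧ (ρ kl.2).1 ∈ 𝔄.final ∧
    (∀ m, kl.1 ≤ m → m < kl.2 → 𝔄.Edge (ρ m) (α m) (ρ (m + 1))) ∧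
    ∀ m, kl.1 ≤ m → m ≤ kl.2 → test (ρ m).1 m}

/-- Formulas of visibly linear dynamic logic over the atomic propositions `P` and the pushdown
alphabet `κ` on `2^P`. The guard of a temporal operator is a testing visibly pushdown automaton
`(𝔄, t)`: a visibly pushdown automaton `𝔄` with finitely many states and stack symbols (numbered,
without loss of generality, by `Fin n` and `Fin m`), and a partial map `t` from states to formulas,
defined on `dom`. -/
inductive VLDL {P : Type*} (κ : Set P → ActionKind) where
  | atom (p : P) : VLDL κ
  | neg (φ : VLDL κ) : VLDL κ
  | and (φ ψ : VLDL κ) : VLDL κ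
  | or (φ ψ : VLDL κ) : VLDL κ
  | diamond {n m : ℕ} (𝔄 : VPA κ (Fin n) (Fin m)) (dom : Set (Fin n)) (t : dom → VLDL κ)
      (φ : VLDL κ) : VLDL κ
  | box {n m : ℕ} (𝔄 : VPA κ (Fin n) (Fin m)) (dom : Set (Fin n)) (t : dom → VLDL κ)
      (φ : VLDL κ) : VLDL κ

/-- `φ.Sat α k` is the satisfaction relation `(α, k) ⊨ φ`. -/
def VLDL.Sat {P : Type*} {κ : Set P → ActionKind} : VLDL κ → (ℕ → Set P) → ℕ → Prop
  | .atom p, α, k => p ∈ α k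
  | .neg φ, α, k => ¬ φ.Sat α k
  | .and φ ψ, α, k => φ.Sat α k ∧ ψ.Sat α k
  | .or φ ψ, α, k => φ.Sat α k ∨ ψ.Sat α k
  | .diamond 𝔄 dom t φ, α, k =>
      ∃ l, k ≤ l ∧ (k, l) ∈ 𝔄.matches (fun q m => ∀ h : q ∈ dom, (t ⟨q, h⟩).Sat α m) α ∧ φ.Sat α l
  | .box 𝔄 dom t φ, α, k =>
      ∀ l, k ≤ l → (k, l) ∈ 𝔄.matches (fun q m => ∀ h : q ∈ dom, (t ⟨q, h⟩).Sat α m) α → φ.Sat α l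

/-- The language of a formula: its models, i.e. the infinite words satisfying it at position `0`. -/
def VLDL.language {P : Type*} {κ : Set P → ActionKind} (φ : VLDL κ) : Set (ℕ → Set P) :=
  {α | φ.Sat α 0}

/-- A two-player game with a VLDL winning condition. The vertices `v` with `owner v = i` are those
of Player `i`. -/
structure VLDLGame {P : Type*} (κ : Set P → ActionKind) (V : Type*) where
  owner : V → Fin 2
  edge : V → V → Prop
  start : V
  label : V → Set P
  cond : VLDL κ

namespace VLDLGame

/-- An initial play. -/
def IsInitialPlay {P : Type*} {κ : Set P → ActionKind} {V : Type*} (G : VLDLGame κ V)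
    (π : ℕ → V) : Prop :=
  π 0 = G.start ∧ ∀ n, G.edge (π n) (π (n + 1))

/-- The trace of a play; it omits the label of the first vertex. -/
def trace {P : Type*} {κ : Set P → ActionKind} {V : Type*} (G : VLDLGame κ V)
    (π : ℕ → V) : ℕ → Set P :=
  fun n => G.label (π (n + 1))

/-- The plays that are winning for Player `i`: for Player `0` those whose trace is a model of the
winning condition, for Player `1` all others. -/
def PlayWonBy {P : Type*} {κ : Set P → ActionKind} {V : Type*} (G : VLDLGame κ V)
    (i : Fin 2) (π : ℕ → V) : Prop :=
  if i = 0 then G.trace π ∈ G.cond.language else G.trace π ∉ G.cond.language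

/-- `σ w v` is the vertex chosen after the history `w · v`, for a vertex `v` of Player `i`. It has
to be a successor of `v`, whenever `v` has a successor. -/
def IsStrategy {P : Type*} {κ : Set P → ActionKind} {V : Type*} (G : VLDLGame κ V)
    (i : Fin 2) (σ : List V → {v : V // G.owner v = i} → V) : Prop :=
  ∀ (w : List V) (v : {v : V // G.owner v = i}),
    (∃ v' : V, G.edge v v') → G.edge v (σ w v)

/-- The play `π` is consistent with `σ`. -/
def Consistent {P : Type*} {κ : Set P → ActionKind} {V : Type*} (G : VLDLGame κ V)
    (i : Fin 2) (σ : List V → {v : V // G.owner v = i} → V) (π : ℕ → V) : Prop :=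
  ∀ (n : ℕ) (h : G.owner (π n) = i), σ ((List.range n).map π) ⟨π n, h⟩ = π (n + 1)

/-- Player `i` has a winning strategy. -/
def Wins {P : Type*} {κ : Set P → ActionKind} {V : Type*} (G : VLDLGame κ V)
    (i : Fin 2) : Prop :=
  ∃ σ : List V → {v : V // G.owner v = i} → V, G.IsStrategy i σ ∧
    ∀ π : ℕ → V, G.IsInitialPlay π → G.Consistent i σ π → G.PlayWonBy i π

/-- One of the players wins. -/
def Determined {P : Type*} {κ : Set P → ActionKind} {V : Type*} (G : VLDLGame κ V) : Prop :=
  G.Wins 0 ∨ G.Wins 1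

end VLDLGame

/-- A visibly pushdown game with a VLDL winning condition; the states `q` with `owner q = i` are
those of Player `i`. -/
structure VPG {P : Type*} (κ : Set P → ActionKind) (Q Γ : Type*) where
  sys : VPS κ Q Γ
  owner : Q → Fin 2
  start : Q
  cond : VLDL κ

/-- The two-player game defined by a visibly pushdown game. Vertices are `(q, γ, a)` with a
configuration `(q, γ)` and a letter `a`; `a₀` is the (irrelevant) label of the initial vertex. -/
def VPG.toGame {P : Type*} {κ : Set P → ActionKind} {Q Γ : Type*} (H : VPG κ Q Γ) (a₀ : Set P) :
    VLDLGame κ (Q × List Γ × Set P) where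
  owner v := H.owner v.1
  edge v v' := H.sys.Edge (v.1, v.2.1) v'.2.2 (v'.1, v'.2.1)
  start := (H.start, [], a₀)
  label v := v.2.2
  cond := H.cond

-- VLDL conditions are Borel, and determinacy follows by Martin's unravelling method. For fixed `k`
-- and `l`, membership of `(k, l)` in `𝔄.matches` is a countable disjunction over finite runs of
-- conditions on single letters and tests. So induction on formulas builds every language from
-- one-letter conditions by complements and countable unions (`VLDL.universallyUnravelled_sat`).
--
-- A covering of `T` by `T'` maps branches to branches and transfers strategies from `T'` to `T` so
-- that each play consistent with a transferred strategy lifts to a play consistent with the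
-- original one. If the preimage of a winning set is clopen in `T'`, the game there is determined as
-- an open game, and the winning strategy is transferred. The invariant `UniversallyUnravelled` asks
-- for such coverings for all continuous preimages in all trees, with any prescribed number of
-- levels unchanged. Complements are then immediate. For a countable union the pieces are unravelled
-- one after the other, fixing more and more levels; in the inverse limit all pieces are clopen, so
-- the union is open and one open set remains to be unravelled (`iUnion_nat`).
--
-- An open set, given by the nodes `D` that guarantee membership, is unravelled by having the
-- outcome announced early: Player `0` commits to a quasi-strategy `S`, and Player `1` either names
-- a node of `D ∩ S` that the play will run through, or has the play stay in `S` and outside Player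
-- `0`'s attractor of `D ∩ S`. This answer decides membership. Attractor strategies allow the
-- transfer for both players (`stratZero_lift`, `stratOne_lift`).
--
-- Finally, a game on an arbitrary arena becomes a game on a tree when both players propose a
-- successor in each round and the proposal of the owner counts.

universe u v

/-! ### Attractors -/

/-- The attractor of `R` for the player owning the vertices in `own`, in the graph `E`, together
with an attracting positional strategy. -/
structure Attractor {V : Type u} (E : V → V → Prop) (own : V → Prop) (R : Set V) where
  carrier : Set V
  move : V → V
  rank : V → Ordinal.{u}
  subset : R ⊆ carrier
  move_spec : ∀ v ∈ carrier, v ∉ R → own v →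
    E v (move v) ∧ move v ∈ carrier ∧ rank (move v) < rank v
  opp_spec : ∀ v ∈ carrier, v ∉ R → ¬ own v → ∀ w, E v w → w ∈ carrier ∧ rank w < rank v
  own_compl : ∀ v ∉ carrier, own v → ∀ w, E v w → w ∉ carrier
  opp_compl : ∀ v ∉ carrier, ¬ own v → ∃ w, E v w ∧ w ∉ carrier

/-- The stages of the attractor construction. -/
inductive AttractorStage {V : Type u} (E : V → V → Prop) (own : V → Prop) (R : Set V) :
    Ordinal.{u} → V → Prop
  | base {o v} : v ∈ R → AttractorStage E own R o v
  | own {o o' v w} : own v → E v w → o' < o → AttractorStage E own R o' w →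
      AttractorStage E own R o v
  | opp {o v} (f : V → Ordinal.{u}) : ¬ own v → (∀ w, E v w → f w < o) →
      (∀ w, E v w → AttractorStage E own R (f w) w) → AttractorStage E own R o v

namespace Attractor

variable {V : Type u} {E : V → V → Prop} {own : V → Prop} {R : Set V}

/-- The rank of a vertex is the first stage containing it, so attracting moves decrease it. Infinite
branching calls for transfinite stages. -/
instance : Nonempty (Attractor E own R) := by
  classical
  let S := AttractorStage E own R
  let W : Set V := {v | ∃ o, S o v}
  let rk : V → Ordinal.{u} := fun v => sInf {o | S o v}
  have hrk : ∀ v ∈ W, S (rk v) v := fun v hv => csInf_mem (s := {o | S o v}) hv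
  have hle : ∀ v o, S o v → rk v ≤ o := fun v o h => csInf_le' (s := {o | S o v}) h
  have hmove : ∀ v, ∃ w, v ∈ W → v ∉ R → own v → E v w ∧ w ∈ W ∧ rk w < rk v := by
    intro v
    by_cases h : v ∈ W ∧ v ∉ R ∧ own v
    · obtain ⟨h1, h2, h3⟩ := h
      cases hrk v h1 with
      | base h => exact absurd h h2
      | @own _ o' _ w _ he hlt hs =>
        exact ⟨w, fun _ _ _ => ⟨he, ⟨o', hs⟩, (hle w o' hs).trans_lt hlt⟩⟩
      | opp f h => exact absurd h3 h
    · exact ⟨v, fun h1 h2 h3 => absurd ⟨h1, h2, h3⟩ h⟩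
  choose mv hmv using hmove
  refine ⟨⟨W, mv, rk, fun v hv => ⟨0, .base hv⟩, hmv, ?_, ?_, ?_⟩⟩
  · intro v h1 h2 h3 w hw
    cases hrk v h1 with
    | base h => exact absurd h h2
    | own h => exact absurd h h3
    | opp f h hlt hs => exact ⟨⟨_, hs w hw⟩, (hle w _ (hs w hw)).trans_lt (hlt w hw)⟩
  · rintro v hv ho w hw ⟨o, hs⟩
    exact hv ⟨Order.succ o, .own ho hw (Order.lt_succ o) hs⟩
  · intro v hv ho
    by_contra! hcon
    -- A stage above all ranks exists because the ordinals live in the universe of `V`; vertices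
    -- outside `W` only contribute the junk rank `0`.
    refine hv ⟨Order.succ (⨆ w, rk w), .opp rk ho (fun w _ => ?_) fun w hw => hrk w (hcon w hw)⟩
    exact Order.lt_succ_of_le (Ordinal.le_iSup rk w)

/-- A path following the attracting strategy reaches the target. -/
theorem reaches (A : Attractor E own R) (x : ℕ → V) (k : ℕ) (hk : x k ∈ A.carrier)
    (hown : ∀ n, k ≤ n → x n ∈ A.carrier → x n ∉ R → own (x n) → x (n + 1) = A.move (x n))
    (hopp : ∀ n, k ≤ n → x n ∈ A.carrier → x n ∉ R → ¬ own (x n) → E (x n) (x (n + 1))) :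
    ∃ n, k ≤ n ∧ x n ∈ R := by
  induction h : A.rank (x k) using WellFoundedLT.induction generalizing k with
  | ind o ih =>
    subst h
    by_cases hR : x k ∈ R
    · exact ⟨k, le_rfl, hR⟩
    have hs : x (k + 1) ∈ A.carrier ∧ A.rank (x (k + 1)) < A.rank (x k) := by
      by_cases ho : own (x k)
      · rw [hown k le_rfl hk hR ho]
        exact (A.move_spec _ hk hR ho).2
      · exact A.opp_spec _ hk hR ho _ (hopp k le_rfl hk hR ho)
    obtain ⟨n, hn, hn'⟩ := ih _ hs.2 (k + 1) hs.1 (fun n hn => hown n (by omega))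
      (fun n hn => hopp n (by omega)) rfl
    exact ⟨n, by omega, hn'⟩

end Attractor

/-! ### Game trees, strategies and coverings -/

/-- A rooted tree without leaves, as the arena of a game in which the nodes of even level belong
to Player `0` and those of odd level to Player `1`. -/
structure GameTree where
  Node : Type u
  level : Node → ℕ
  parent : Node → Node
  root : Node
  level_parent : ∀ v, level (parent v) = level v - 1
  level_root : level root = 0
  eq_root : ∀ v, level v = 0 → v = root
  exists_child : ∀ v, ∃ w, level w = level v + 1 ∧ parent w = v

namespace GameTree

def IsChild (T : GameTree.{u}) (v w : T.Node) : Prop :=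
  T.level w = T.level v + 1 ∧ T.parent w = v

/-- The infinite branches of a tree. -/
@[ext]
structure Branch (T : GameTree.{u}) where
  node : ℕ → T.Node
  level_node : ∀ n, T.level (node n) = n
  parent_node : ∀ n, T.parent (node (n + 1)) = node n

/-- A strategy, for either player; only the values on the nodes of that player matter. -/
@[ext]
structure Strategy (T : GameTree.{u}) where
  next : T.Node → T.Node
  isChild : ∀ v, T.IsChild v (next v)

instance (T : GameTree.{u}) : Nonempty T.Strategy := by
  choose f hf using T.exists_child
  exact ⟨⟨f, hf⟩⟩

/-- The branch `x` is consistent with the strategy `s` for Player `i`. -/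
def Follows {T : GameTree.{u}} (i : Fin 2) (s : T.Strategy) (x : T.Branch) : Prop :=
  ∀ n, n % 2 = i.val → x.node (n + 1) = s.next (x.node n)

theorem Branch.isChild {T : GameTree.{u}} (x : T.Branch) (n : ℕ) :
    T.IsChild (x.node n) (x.node (n + 1)) :=
  ⟨by rw [x.level_node, x.level_node], x.parent_node n⟩

/-- Two strategies agree on the nodes of level at most `n`. -/
def AgreeUpTo {T : GameTree.{u}} (n : ℕ) (s s' : T.Strategy) : Prop :=
  ∀ v, T.level v ≤ n → s.next v = s'.next v

/-- The branch obtained by starting in the root and following `f`. -/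
theorem exists_branch (T : GameTree.{u}) (f : T.Node → T.Node) (hf : ∀ v, T.IsChild v (f v)) :
    ∃ x : T.Branch, ∀ n, x.node (n + 1) = f (x.node n) := by
  let x : ℕ → T.Node := fun n => f^[n] T.root
  have hx : ∀ n, x (n + 1) = f (x n) := fun n => Function.iterate_succ_apply' f n _
  have hl : ∀ n, T.level (x n) = n := by
    intro n
    induction n with
    | zero => exact T.level_root
    | succ n ih => rw [hx, (hf _).1, ih]
  exact ⟨⟨x, hl, fun n => by rw [hx, (hf _).2]⟩, hx⟩

/-- A set of branches is open. -/
def IsOpenSet {T : GameTree.{u}} (A : Set T.Branch) : Prop :=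
  ∀ x ∈ A, ∃ n, ∀ y : T.Branch, y.node n = x.node n → y ∈ A

def IsClopenSet {T : GameTree.{u}} (A : Set T.Branch) : Prop :=
  IsOpenSet A ∧ IsOpenSet Aᶜ

/-- A map from branches to words is continuous. -/
def Continuous {T : GameTree.{u}} {L : Type v} (f : T.Branch → ℕ → L) : Prop :=
  ∀ x n, ∃ m, ∀ y : T.Branch, y.node m = x.node m → f y n = f x n

/-- A covering of the tree `T` by the tree `T'` that is the identity up to level `N`. -/
structure Cover (N : ℕ) (T' T : GameTree.{u}) where
  map : T'.Node → T.Node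
  level_map : ∀ v, T.level (map v) = T'.level v
  parent_map : ∀ v, map (T'.parent v) = T.parent (map v)
  injective : ∀ v w, T'.level v ≤ N → T'.level w ≤ N → map v = map w → v = w
  surjective : ∀ v, T.level v ≤ N → ∃ w, map w = v
  strat : Fin 2 → T'.Strategy → T.Strategy
  agree : ∀ i n s s', AgreeUpTo n s s' → AgreeUpTo n (strat i s) (strat i s')
  strat_map : ∀ i s v, T'.level v < N → (strat i s).next (map v) = map (s.next v)
  lift : ∀ i s (x : T.Branch), Follows i (strat i s) x →
    ∃ x' : T'.Branch, Follows i s x' ∧ ∀ n, map (x'.node n) = x.node n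

namespace Cover

variable {N : ℕ} {T T' T'' : GameTree.{u}}

/-- The map on branches induced by a covering. -/
def branchMap (c : Cover N T' T) (x : T'.Branch) : T.Branch where
  node n := c.map (x.node n)
  level_node n := by rw [c.level_map, x.level_node]
  parent_node n := by rw [← c.parent_map, x.parent_node]

def id (N : ℕ) (T : GameTree.{u}) : Cover N T T where
  map v := v
  level_map _ := rfl
  parent_map _ := rfl
  injective _ _ _ _ h := h
  surjective v _ := ⟨v, rfl⟩
  strat _ s := s
  agree _ _ _ _ h := h
  strat_map _ _ _ _ := rfl
  lift _ _ x h := ⟨x, h, fun _ => rfl⟩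

def mono {M : ℕ} (c : Cover M T' T) (h : N ≤ M) : Cover N T' T where
  __ := c
  injective v w hv hw := c.injective v w (hv.trans h) (hw.trans h)
  surjective v hv := c.surjective v (hv.trans h)
  strat_map i s v hv := c.strat_map i s v (hv.trans_le h)

def comp (c : Cover N T' T) (d : Cover N T'' T') : Cover N T'' T where
  map v := c.map (d.map v)
  level_map v := by rw [c.level_map, d.level_map]
  parent_map v := by rw [d.parent_map, c.parent_map]
  injective v w hv hw h :=
    d.injective v w hv hw (c.injective _ _ (by rwa [d.level_map]) (by rwa [d.level_map]) h)
  surjective v hv := by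
    obtain ⟨w, rfl⟩ := c.surjective v hv
    obtain ⟨z, rfl⟩ := d.surjective w (by rwa [← c.level_map])
    exact ⟨z, rfl⟩
  strat i s := c.strat i (d.strat i s)
  agree i n s s' h := c.agree i n _ _ (d.agree i n _ _ h)
  strat_map i s v hv := by
    rw [c.strat_map _ _ _ (by rwa [d.level_map]), d.strat_map _ _ _ hv]
  lift i s x hx := by
    obtain ⟨y, hy, hyx⟩ := c.lift i _ x hx
    obtain ⟨z, hz, hzy⟩ := d.lift i _ y hy
    exact ⟨z, hz, fun n => by rw [hzy, hyx]⟩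

theorem map_root (c : Cover N T' T) : c.map T'.root = T.root :=
  T.eq_root _ (by rw [c.level_map, T'.level_root])

end Cover

/-! ### Inverse limits of coverings -/

section Limit

variable {N : ℕ} {T : ℕ → GameTree.{u}} (c : ∀ i, Cover (N + i) (T (i + 1)) (T i))

def IsThread (v : ∀ i, (T i).Node) : Prop := ∀ i, (c i).map (v (i + 1)) = v i

variable {c}

theorem IsThread.level {v : ∀ i, (T i).Node} (h : IsThread c v) (i : ℕ) :
    (T i).level (v i) = (T 0).level (v 0) := by
  induction i with
  | zero => rfl
  | succ i ih => rw [← (c i).level_map, h i, ih]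

/-- From index `i` on, the coverings are injective at the level of the thread, so component `i`
determines the later ones; the earlier ones are its images. -/
theorem IsThread.ext {v w : ∀ i, (T i).Node} (hv : IsThread c v) (hw : IsThread c w) (i : ℕ)
    (hi : (T i).level (v i) ≤ N + i) (h : v i = w i) : v = w := by
  have up : ∀ j, i ≤ j → v j = w j := by
    intro j hj
    induction j, hj using Nat.le_induction with
    | base => exact h
    | succ j hj ih =>
      have l1 := hv.level i
      have l2 := hv.level j
      have l3 := hv.level (j + 1)
      have l4 := hw.level j
      have l5 := hw.level (j + 1)
      have l6 := congrArg (T j).level ih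
      refine (c j).injective _ _ (by omega) (by omega) ?_
      rw [hv j, hw j, ih]
  have down : ∀ d j, i ≤ j + d → v j = w j := by
    intro d
    induction d with
    | zero => exact fun j hj => up j (by omega)
    | succ d ih =>
      intro j hj
      rw [← hv j, ← hw j, ih (j + 1) (by omega)]
  exact funext fun j => down i j (by omega)

-- Earlier components are images under the coverings. Later ones are chosen preimages, which exist
-- because the coverings from index `i` on are surjective at this level.
variable (c) in
theorem exists_thread (i : ℕ) (w : (T i).Node) (hw : (T i).level w ≤ N + i) :
    ∃ v : ∀ j, (T j).Node, IsThread c v ∧ v i = w := by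
  classical
  have up : ∃ v : ∀ j, (T j).Node, v i = w ∧ ∀ j, i ≤ j → (c j).map (v (j + 1)) = v j := by
    -- The roots below index `i` are placeholders, replaced one at a time in `down`.
    let v₀ : ∀ j, (T j).Node := Function.update (fun j => (T j).root) i w
    let step : ∀ j, (T j).Node → (T (j + 1)).Node := fun j z =>
      if j + 1 ≤ i then v₀ (j + 1) else
        if h : ∃ y, (c j).map y = z then h.choose else (T (j + 1)).root
    let v : ∀ j, (T j).Node := fun j => Nat.rec (v₀ 0) step j
    have hv₀ : v₀ i = w := by simp [v₀]
    have hv : v i = w := by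
      cases i with
      | zero => exact hv₀
      | succ i => exact (if_pos le_rfl).trans hv₀
    have key : ∀ j, i ≤ j → (T j).level (v j) = (T i).level w ∧
        (c j).map (v (j + 1)) = v j := by
      have step' : ∀ j, i ≤ j → (T j).level (v j) = (T i).level w →
          (c j).map (v (j + 1)) = v j := by
        intro j hj hl
        have hex : ∃ y, (c j).map y = v j := (c j).surjective _ (by omega)
        have e : v (j + 1) = hex.choose :=
          (if_neg (by omega : ¬ j + 1 ≤ i)).trans (dif_pos hex)
        rw [e]
        exact hex.choose_spec
      intro j hj
      induction j, hj using Nat.le_induction with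
      | base => exact ⟨by rw [hv], step' i le_rfl (by rw [hv])⟩
      | succ j hj ih =>
        have l : (T (j + 1)).level (v (j + 1)) = (T i).level w := by
          rw [← (c j).level_map, ih.2, ih.1]
        exact ⟨l, step' _ (by omega) l⟩
    exact ⟨v, hv, fun j hj => (key j hj).2⟩
  have down : ∀ d, d ≤ i → ∃ v : ∀ j, (T j).Node, v i = w ∧
      ∀ j, i - d ≤ j → (c j).map (v (j + 1)) = v j := by
    intro d
    induction d with
    | zero => exact fun _ => up
    | succ d ih =>
      intro hd
      obtain ⟨v, hv, h⟩ := ih (by omega)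
      obtain ⟨e, he⟩ : ∃ e, e + 1 = i - d := ⟨i - (d + 1), by omega⟩
      refine ⟨Function.update v e ((c e).map (v (e + 1))), ?_, fun j hj => ?_⟩
      · rw [Function.update_of_ne (by omega), hv]
      · rw [Function.update_of_ne (by omega : j + 1 ≠ e) ]
        by_cases hje : j = e
        · subst hje
          rw [Function.update_self]
        · rw [Function.update_of_ne hje, h j (by omega)]
  obtain ⟨v, hv, h⟩ := down i le_rfl
  exact ⟨v, fun j => h j (by omega), hv⟩

theorem IsThread.parent {v : ∀ i, (T i).Node} (h : IsThread c v) :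
    IsThread c fun i => (T i).parent (v i) := fun i => by
  rw [(c i).parent_map, h i]

variable (c) in
/-- The inverse limit of a sequence of coverings. -/
def limit : GameTree.{u} where
  Node := {v : ∀ i, (T i).Node // IsThread c v}
  level v := (T 0).level (v.1 0)
  parent v := ⟨fun i => (T i).parent (v.1 i), v.2.parent⟩
  root := ⟨fun i => (T i).root, fun i => (c i).map_root⟩
  level_parent v := (T 0).level_parent _
  level_root := (T 0).level_root
  eq_root v hv := Subtype.ext (funext fun i => (T i).eq_root _ (by rw [v.2.level, hv]))
  exists_child v := by
    -- A child has level `i + 1`, so it is determined by its component of index `i + 1`, whatever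
    -- `N` is.
    let i := (T 0).level (v.1 0)
    obtain ⟨w, hw1, hw2⟩ := (T (i + 1)).exists_child (v.1 (i + 1))
    rw [v.2.level] at hw1
    obtain ⟨z, hz, rfl⟩ := exists_thread c (i + 1) w (by omega)
    rw [hz.level] at hw1
    refine ⟨⟨z, hz⟩, hw1, Subtype.ext (hz.parent.ext v.2 (i + 1) ?_ hw2)⟩
    rw [hw2, v.2.level]
    omega

theorem limit_level (v : (limit c).Node) (i : ℕ) :
    (T i).level (v.1 i) = (limit c).level v := v.2.level i

theorem limit_ext {v w : (limit c).Node} (i : ℕ) (hi : (limit c).level v ≤ N + i)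
    (h : v.1 i = w.1 i) : v = w :=
  Subtype.ext (v.2.ext w.2 i (by rwa [v.2.level]) h)

variable (c) in
theorem exists_limit_node (i : ℕ) (w : (T i).Node) (hw : (T i).level w ≤ N + i) :
    ∃ v : (limit c).Node, v.1 i = w := by
  obtain ⟨v, hv, h⟩ := exists_thread c i w hw
  exact ⟨⟨v, hv⟩, h⟩

open Classical in
/-- The strategy on the `i`-th tree that copies a strategy on the limit, as far as the trees
coincide. -/
noncomputable def limitCopy (s : (limit c).Strategy) (i : ℕ) : (T i).Strategy where
  next w := if h : (T i).level w < N + i then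
      (s.next (exists_limit_node c i w h.le).choose).1 i
    else (Classical.arbitrary (T i).Strategy).next w
  isChild w := by
    split_ifs with h
    · have e := (exists_limit_node c i w h.le).choose_spec
      have hs := s.isChild (exists_limit_node c i w h.le).choose
      refine ⟨?_, ?_⟩
      · rw [limit_level, hs.1, ← limit_level _ i, e]
      · conv_rhs => rw [← e, ← hs.2]
        rfl
    · exact (Classical.arbitrary (T i).Strategy).isChild w

theorem limitCopy_next (s : (limit c).Strategy) (i : ℕ) (v : (limit c).Node)
    (hv : (limit c).level v < N + i) : (limitCopy s i).next (v.1 i) = (s.next v).1 i := by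
  have h : (T i).level (v.1 i) < N + i := by rwa [limit_level]
  have e : (exists_limit_node c i (v.1 i) h.le).choose = v :=
    (limit_ext i hv.le (exists_limit_node c i (v.1 i) h.le).choose_spec.symm).symm
  exact (dif_pos h).trans (by rw [e])

theorem limitCopy_agree {n : ℕ} {s s' : (limit c).Strategy} (h : AgreeUpTo n s s') (i : ℕ) :
    AgreeUpTo n (limitCopy s i) (limitCopy s' i) := by
  intro w hw
  simp only [limitCopy]
  split_ifs with hl
  · rw [h]
    rwa [← limit_level _ i, (exists_limit_node c i w hl.le).choose_spec]
  · rfl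

/-- The `d`-th approximation to the strategy on the `i`-th tree induced by a strategy on the
limit. -/
noncomputable def limitApprox (b : Fin 2) (s : (limit c).Strategy) :
    ℕ → ∀ i, (T i).Strategy
  | 0, i => limitCopy s i
  | d + 1, i => (c i).strat b (limitApprox b s d (i + 1))

theorem limitApprox_agree {n : ℕ} {s s' : (limit c).Strategy} (h : AgreeUpTo n s s') (b : Fin 2)
    (d i : ℕ) : AgreeUpTo n (limitApprox b s d i) (limitApprox b s' d i) := by
  induction d generalizing i with
  | zero => exact limitCopy_agree h i
  | succ d ih => exact (c i).agree b n _ _ (ih (i + 1))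

/-- The two approximations differ by one use of the covering of index `i + d`, which merely copies
strategies below level `N + i + d`; `agree` carries the equality down through the other coverings.
-/
theorem limitApprox_succ (b : Fin 2) (s : (limit c).Strategy) (d i : ℕ) (w : (T i).Node)
    (hw : (T i).level w < N + i + d) :
    (limitApprox b s (d + 1) i).next w = (limitApprox b s d i).next w := by
  induction d generalizing i with
  | zero =>
    obtain ⟨v, rfl⟩ := exists_limit_node c i w (by omega)
    rw [limit_level] at hw
    have e : (c i).map (v.1 (i + 1)) = v.1 i := v.2 i
    simp only [limitApprox]
    rw [limitCopy_next s i v (by omega), ← e, (c i).strat_map _ _ _ (by rw [limit_level]; omega),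
      limitCopy_next s (i + 1) v (by omega), (s.next v).2 i]
  | succ d ih =>
    exact (c i).agree b ((T i).level w) _ _
      (fun z hz => ih (i + 1) z (by omega)) w le_rfl

theorem limitApprox_eq (b : Fin 2) (s : (limit c).Strategy) {d e i : ℕ} (w : (T i).Node)
    (hw : (T i).level w < N + i + d) (hde : d ≤ e) :
    (limitApprox b s e i).next w = (limitApprox b s d i).next w := by
  induction e, hde using Nat.le_induction with
  | base => rfl
  | succ e he ih => rw [limitApprox_succ b s e i w (by omega), ih]

/-- The strategy on the `i`-th tree induced by a strategy on the limit. -/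
noncomputable def limitStrat (b : Fin 2) (s : (limit c).Strategy) (i : ℕ) : (T i).Strategy where
  next w := (limitApprox b s ((T i).level w + 1) i).next w
  isChild w := (limitApprox b s ((T i).level w + 1) i).isChild w

/-- The stable values of the approximations form a compatible family, so that plays can be lifted
through one covering at a time. -/
theorem limitStrat_step (b : Fin 2) (s : (limit c).Strategy) (i : ℕ) :
    limitStrat b s i = (c i).strat b (limitStrat b s (i + 1)) := by
  refine Strategy.ext (funext fun w => ?_)
  set n := (T i).level w with hn
  have h : AgreeUpTo n (limitStrat b s (i + 1)) (limitApprox b s (n + 1) (i + 1)) := by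
    intro z hz
    exact (limitApprox_eq b s z (by omega) (by omega)).symm
  rw [(c i).agree b n _ _ h w le_rfl]
  exact (limitApprox_eq b s w (by omega) (Nat.le_succ _)).symm

theorem limitStrat_next (b : Fin 2) (s : (limit c).Strategy) (i : ℕ) (v : (limit c).Node)
    (hv : (limit c).level v < N + i) : (limitStrat b s i).next (v.1 i) = (s.next v).1 i := by
  have hl := limit_level v i
  exact (limitApprox_eq b s (v.1 i) (by omega) (Nat.zero_le _)).trans (limitCopy_next s i v hv)

/-- The projection of branches of the limit to the `i`-th tree. -/
def limitProj (i : ℕ) (x : (limit c).Branch) : (T i).Branch where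
  node n := (x.node n).1 i
  level_node n := by rw [limit_level, x.level_node]
  parent_node n := by rw [← x.parent_node n]; rfl

variable (c) in
/-- The limit covers the first tree. -/
noncomputable def limitCover : Cover N (limit c) (T 0) where
  map v := v.1 0
  level_map _ := rfl
  parent_map _ := rfl
  injective v w hv _ h := limit_ext 0 hv h
  surjective v hv := exists_limit_node c 0 v hv
  strat b s := limitStrat b s 0
  agree b n s s' h w hw := limitApprox_agree h b _ 0 w hw
  strat_map b s v hv := limitStrat_next b s 0 v hv
  lift b s x hx := by
    have step : ∀ i (y : (T i).Branch), ∃ z : (T (i + 1)).Branch,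
        Follows b (limitStrat b s i) y → Follows b (limitStrat b s (i + 1)) z ∧
          ∀ n, (c i).map (z.node n) = y.node n := by
      intro i y
      by_cases hy : Follows b (limitStrat b s i) y
      · rw [limitStrat_step] at hy
        obtain ⟨z, hz⟩ := (c i).lift b _ y hy
        exact ⟨z, fun _ => hz⟩
      · obtain ⟨z, _⟩ := (T (i + 1)).exists_branch _
          (Classical.arbitrary (T (i + 1)).Strategy).isChild
        exact ⟨z, fun h => absurd h hy⟩
    choose up hup using step
    let X : ∀ i, (T i).Branch := fun i => Nat.rec x up i
    have hX : ∀ i, Follows b (limitStrat b s i) (X i) := by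
      intro i
      induction i with
      | zero => exact hx
      | succ i ih => exact (hup i _ ih).1
    let y : (limit c).Branch :=
      { node := fun n => ⟨fun i => (X i).node n, fun i => (hup i _ (hX i)).2 n⟩
        level_node := fun n => x.level_node n
        parent_node := fun n => Subtype.ext (funext fun i => (X i).parent_node n) }
    refine ⟨y, fun n hn => ?_, fun n => rfl⟩
    have l := y.level_node n
    -- Component `n + 1` suffices: its tree agrees with the limit up to level `N + n + 1`, and both
    -- nodes have level `n + 1`.
    refine limit_ext (n + 1) (by rw [y.level_node]; omega) ?_
    rw [← limitStrat_next b s _ _ (by rw [l]; omega)]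
    exact hX (n + 1) n hn

end Limit

end GameTree

/-! ### Unravelling an open set: quasi-strategies and decorated nodes -/

namespace GameTree

variable {T : GameTree.{u}}

/-- The ancestor of `v` at level `m`, or `v` itself if its level is less than `m`. -/
def trunc (v : T.Node) (m : ℕ) : T.Node := T.parent^[T.level v - m] v

theorem level_iterate_parent (k : ℕ) (v : T.Node) :
    T.level (T.parent^[k] v) = T.level v - k := by
  induction k with
  | zero => rfl
  | succ k ih => rw [Function.iterate_succ_apply', T.level_parent, ih, Nat.sub_sub]

theorem level_trunc (v : T.Node) (m : ℕ) : T.level (trunc v m) = min m (T.level v) := by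
  rw [trunc, level_iterate_parent]
  omega

theorem trunc_of_level_le {v : T.Node} {m : ℕ} (h : T.level v ≤ m) : trunc v m = v := by
  rw [trunc, Nat.sub_eq_zero_of_le h]
  rfl

theorem trunc_parent {v : T.Node} {m : ℕ} (h : m < T.level v) :
    trunc (T.parent v) m = trunc v m := by
  rw [trunc, trunc, T.level_parent, ← Function.iterate_succ_apply]
  congr 2
  omega

theorem parent_trunc {v : T.Node} {m : ℕ} (h : m < T.level v) :
    T.parent (trunc v (m + 1)) = trunc v m := by
  rw [trunc, trunc, ← Function.iterate_succ_apply' T.parent]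
  congr 2
  omega

theorem trunc_trunc (v : T.Node) {m k : ℕ} (h : m ≤ k) : trunc (trunc v k) m = trunc v m := by
  by_cases hk : T.level v ≤ k
  · rw [trunc_of_level_le hk]
  · rw [trunc, level_trunc, trunc, trunc, ← Function.iterate_add_apply]
    congr 2
    omega

theorem IsChild.trunc {v w : T.Node} (h : T.IsChild v w) {m : ℕ} (hm : m ≤ T.level v) :
    trunc w m = trunc v m := by
  rw [← h.2, trunc_parent (by rw [h.1]; omega)]

theorem Branch.trunc_node (x : T.Branch) {m n : ℕ} (h : m ≤ n) :
    trunc (x.node n) m = x.node m := by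
  induction n, h using Nat.le_induction with
  | base => exact trunc_of_level_le (x.level_node m).le
  | succ n h ih => rw [(x.isChild n).trunc (by rwa [x.level_node]), ih]

/-- A quasi-strategy for Player `0`: all moves of Player `1` are allowed, and at least one of each
node of Player `0`. -/
def IsQuasiStrategy (S : Set T.Node) : Prop :=
  ∀ v ∈ S, (T.level v % 2 = 1 → ∀ w, T.IsChild v w → w ∈ S) ∧
    (T.level v % 2 = 0 → ∃ w, T.IsChild v w ∧ w ∈ S)

theorem isQuasiStrategy_univ : IsQuasiStrategy (Set.univ : Set T.Node) := fun v _ =>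
  ⟨fun _ _ _ => trivial, fun _ => (T.exists_child v).imp fun _ h => ⟨h, trivial⟩⟩

/-- The attractor of `D ∩ S` for Player `0` in the subgame given by the quasi-strategy `S`. -/
noncomputable def attractorIn (D S : Set T.Node) :
    Attractor (fun v w => T.IsChild v w ∧ w ∈ S) (fun v => T.level v % 2 = 0) (D ∩ S) :=
  Classical.choice inferInstance

/-- The attractor of `U` for Player `1`. -/
noncomputable def attractorOne (U : Set T.Node) :
    Attractor T.IsChild (fun v => T.level v % 2 = 1) U :=
  Classical.choice inferInstance

/-- Outside the attractor, no move of Player `1` leads into it and Player `0` has a move avoiding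
it. -/
theorem isQuasiStrategy_compl_attractorOne (U : Set T.Node) :
    IsQuasiStrategy (attractorOne U).carrierᶜ := fun v hv =>
  ⟨fun h w hw => (attractorOne U).own_compl v hv h w hw,
    fun h => (attractorOne U).opp_compl v hv (by omega)⟩

/-- Take attracting moves for Player `0` and any moves for Player `1`: the rank decreases until `D ∩
S` is reached. The node found is a goal that Player `1` may name. -/
theorem exists_goal {D S : Set T.Node} (hS : IsQuasiStrategy S) {v : T.Node}
    (hv : v ∈ (attractorIn D S).carrier) (hvS : v ∈ S) :
    ∃ u ∈ D ∩ S, T.level v ≤ T.level u ∧ trunc u (T.level v) = v := by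
  set A := attractorIn D S
  induction h : A.rank v using WellFoundedLT.induction generalizing v with
  | ind o ih =>
    subst h
    by_cases hR : v ∈ D ∩ S
    · exact ⟨v, hR, le_rfl, trunc_of_level_le le_rfl⟩
    have hs : ∃ w, T.IsChild v w ∧ w ∈ S ∧ w ∈ A.carrier ∧ A.rank w < A.rank v := by
      by_cases ho : T.level v % 2 = 0
      · have := A.move_spec v hv hR ho
        exact ⟨_, this.1.1, this.1.2, this.2⟩
      · obtain ⟨w, hw⟩ := T.exists_child v
        have hwS := (hS v hvS).1 (by omega) w hw
        exact ⟨w, hw, hwS, A.opp_spec v hv hR ho w ⟨hw, hwS⟩⟩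
    obtain ⟨w, hw, hwS, hwA, hlt⟩ := hs
    obtain ⟨u, hu, hle, ht⟩ := ih _ hlt hwS hwA rfl
    refine ⟨u, hu, by have := hw.1; omega, ?_⟩
    rw [hw.1] at ht hle
    rw [← parent_trunc (by omega), ht, hw.2]

/-- The decorations `(v, S, r)` of nodes in the tree unravelling `{x | ∃ n, x.node n ∈ D}`: from
level `N + 1` on the quasi-strategy `S` chosen by Player `0`, from level `N + 2` on the answer `r`
of Player `1`, which is either a node of `D ∩ S` the play has to run through, or the promise to
avoid the attractor of `D ∩ S`. -/
structure Valid (N : ℕ) (D : Set T.Node) (p : T.Node × Set T.Node × Option T.Node) : Prop where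
  quasi : IsQuasiStrategy p.2.1
  low_set : T.level p.1 ≤ N → p.2.1 = Set.univ
  low_goal : T.level p.1 ≤ N + 1 → p.2.2 = none
  mem : N + 1 ≤ T.level p.1 → trunc p.1 (N + 1) ∈ p.2.1
  stay : p.2.2 = none → ∀ m, N + 2 ≤ m → m ≤ T.level p.1 →
    trunc p.1 m ∈ p.2.1 ∧ trunc p.1 m ∉ (attractorIn D p.2.1).carrier
  goal : ∀ u, p.2.2 = some u → u ∈ D ∩ p.2.1 ∧ N + 2 ≤ T.level u ∧
    ∀ m, m ≤ T.level u → m ≤ T.level p.1 → trunc u m = trunc p.1 m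

open Classical in
/-- The node `v` with the decoration appropriate for its level. -/
noncomputable def decorate (N : ℕ) (v : T.Node) (S : Set T.Node) (r : Option T.Node) :
    T.Node × Set T.Node × Option T.Node :=
  (v, if T.level v ≤ N then Set.univ else S, if T.level v ≤ N + 1 then none else r)

variable {N : ℕ} {D : Set T.Node}

theorem Valid.parent {p : T.Node × Set T.Node × Option T.Node} (h : Valid N D p) :
    Valid N D (decorate N (T.parent p.1) p.2.1 p.2.2) := by
  obtain ⟨v, S, r⟩ := p
  obtain ⟨h1, h2, h3, h4, h5, h6⟩ := h
  dsimp only at *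
  have hl := T.level_parent v
  constructor <;> simp only [decorate]
  · split_ifs
    exacts [isQuasiStrategy_univ, h1]
  · exact fun h => if_pos h
  · exact fun h => if_pos h
  · intro h
    rw [if_neg (by omega), trunc_parent (by omega)]
    exact h4 (by omega)
  · intro h m hm hm'
    rw [if_neg (by omega)] at h ⊢
    rw [trunc_parent (by omega)]
    exact h5 h m hm (by omega)
  · intro u h
    have hn : ¬ T.level (T.parent v) ≤ N + 1 := fun hn => by simp [if_pos hn] at h
    rw [if_neg hn] at h
    rw [if_neg (by omega)]
    obtain ⟨a, b, e⟩ := h6 u h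
    exact ⟨a, b, fun m hm hm' => by rw [trunc_parent (by omega), e m hm (by omega)]⟩

theorem valid_of_level_le {v : T.Node} (h : T.level v ≤ N) (S : Set T.Node)
    (r : Option T.Node) : Valid N D (decorate N v S r) := by
  have e : decorate N v S r = (v, Set.univ, none) := by
    rw [decorate, if_pos h, if_pos (by omega)]
  rw [e]
  exact ⟨isQuasiStrategy_univ, fun _ => rfl, fun _ => rfl, fun _ => trivial,
    fun _ m h1 h2 => by dsimp only at h2; omega, fun u h => by simp at h⟩

/-- At level `N + 1`, which belongs to Player `1` as `N` is even, a move inside `S` either enters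
the attractor, and `exists_goal` supplies a goal, or permits the promise. The promise can be kept
forever, since Player `0` cannot enter the attractor from outside and Player `1` need not; a goal is
approached along its ancestors. -/
theorem Valid.exists_child (hN : N % 2 = 0) {p : T.Node × Set T.Node × Option T.Node}
    (h : Valid N D p) : ∃ q, Valid N D q ∧ T.level q.1 = T.level p.1 + 1 ∧
      decorate N (T.parent q.1) q.2.1 q.2.2 = p := by
  obtain ⟨v, S, r⟩ := p
  obtain ⟨h1, h2, h3, h4, h5, h6⟩ := h
  dsimp only at *
  -- The decorations erased in passing to the parent are exactly those not yet chosen at `v`; up to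
  -- level `N + 1` the child's answer is therefore free.
  have dec : ∀ w, T.IsChild v w → (T.level v ≤ N + 1 → ∀ r', decorate N (T.parent w) S r' =
      (v, S, r)) ∧ decorate N (T.parent w) S r = (v, S, r) := by
    intro w hw
    rw [hw.2]
    have e : (if T.level v ≤ N then Set.univ else S) = S := by
      split_ifs with hl
      exacts [(h2 hl).symm, rfl]
    simp only [decorate]
    refine ⟨fun hl r' => by rw [e, if_pos hl, h3 hl], ?_⟩
    rw [e]
    split_ifs with hl
    · rw [h3 hl]
    · rfl
  rcases Nat.lt_or_ge N (T.level v) with hl | hl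
  swap
  · obtain ⟨w, hw⟩ := T.exists_child v
    have hw1 := hw.1
    obtain rfl := h2 hl
    obtain rfl := h3 (by omega)
    refine ⟨(w, Set.univ, none), ⟨h1, fun _ => rfl, fun _ => rfl, fun _ => trivial, ?_, ?_⟩,
      hw.1, (dec w hw).2⟩
    · intro _ m hm hm'
      dsimp only at hm'
      omega
    · intro u hu
      simp at hu
  rcases Nat.lt_or_ge (N + 1) (T.level v) with hl' | hl'
  · rcases r with _ | u
    · have hvs := h5 rfl _ hl' le_rfl
      rw [trunc_of_level_le le_rfl] at hvs
      have hex : ∃ w, T.IsChild v w ∧ w ∈ S ∧ w ∉ (attractorIn D S).carrier := by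
        by_cases ho : T.level v % 2 = 0
        · obtain ⟨w, hw, hwS⟩ := (h1 v hvs.1).2 ho
          exact ⟨w, hw, hwS, (attractorIn D S).own_compl v hvs.2 ho w ⟨hw, hwS⟩⟩
        · obtain ⟨w, hw, hw'⟩ := (attractorIn D S).opp_compl v hvs.2 ho
          exact ⟨w, hw.1, hw.2, hw'⟩
      obtain ⟨w, hw, hwS, hwA⟩ := hex
      have hw1 := hw.1
      refine ⟨(w, S, none), ⟨h1, ?_, ?_, ?_, ?_, ?_⟩, hw.1, (dec w hw).2⟩
      · exact fun h => absurd h (by dsimp only; omega)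
      · exact fun h => rfl
      · exact fun _ => by rw [hw.trunc hl]; exact h4 hl
      · intro _ m hm hm'
        dsimp only at *
        rcases Nat.lt_or_ge (T.level v) m with hmv | hmv
        · rw [trunc_of_level_le (by omega)]
          exact ⟨hwS, hwA⟩
        · rw [hw.trunc hmv]
          exact h5 rfl m hm hmv
      · intro u hu
        simp at hu
    · obtain ⟨hu, hul, hut⟩ := h6 u rfl
      have hex : ∃ w, T.IsChild v w ∧ (T.level v < T.level u → trunc u (T.level v + 1) = w) := by
        by_cases hlt : T.level v < T.level u
        · refine ⟨trunc u (T.level v + 1), ⟨by rw [level_trunc]; omega, ?_⟩, fun _ => rfl⟩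
          rw [parent_trunc hlt, hut _ hlt.le le_rfl, trunc_of_level_le le_rfl]
        · obtain ⟨w, hw⟩ := T.exists_child v
          exact ⟨w, hw, fun h => absurd h hlt⟩
      obtain ⟨w, hw, hwu⟩ := hex
      have hw1 := hw.1
      refine ⟨(w, S, some u), ⟨h1, ?_, ?_, ?_, ?_, ?_⟩, hw.1, (dec w hw).2⟩
      · exact fun h => absurd h (by dsimp only; omega)
      · exact fun h => absurd h (by dsimp only; omega)
      · exact fun _ => by rw [hw.trunc hl]; exact h4 hl
      · intro h
        simp at h
      · rintro _ ⟨⟩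
        refine ⟨hu, hul, fun m hm hm' => ?_⟩
        dsimp only at *
        rcases Nat.lt_or_ge (T.level v) m with hmv | hmv
        · obtain rfl : m = T.level v + 1 := by omega
          rw [hwu hm, trunc_of_level_le (v := w) (by omega)]
        · rw [hw.trunc hmv, hut m hm hmv]
  · have hlv : T.level v = N + 1 := by omega
    have hvS := h4 hl
    rw [trunc_of_level_le hl'] at hvS
    obtain ⟨w, hw⟩ := T.exists_child v
    have hwS := (h1 v hvS).1 (by omega) w hw
    replace hw : T.IsChild v w := hw
    have hw1 := hw.1
    by_cases hA : w ∈ (attractorIn D S).carrier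
    · obtain ⟨u, hu, hul, hut⟩ := exists_goal h1 hA hwS
      refine ⟨(w, S, some u), ⟨h1, ?_, ?_, ?_, ?_, ?_⟩, hw.1, (dec w hw).1 hl' _⟩
      · exact fun h => absurd h (by dsimp only; omega)
      · exact fun h => absurd h (by dsimp only; omega)
      · exact fun _ => by rw [hw.trunc hl]; exact h4 hl
      · intro h
        simp at h
      · rintro _ ⟨⟩
        refine ⟨hu, by omega, fun m hm hm' => ?_⟩
        dsimp only at hm' ⊢
        have e := trunc_trunc u hm'
        rw [hut] at e
        exact e.symm
    · refine ⟨(w, S, none), ⟨h1, ?_, ?_, ?_, ?_, ?_⟩, hw.1, (dec w hw).1 hl' _⟩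
      · exact fun h => absurd h (by dsimp only; omega)
      · exact fun h => rfl
      · exact fun _ => by rw [hw.trunc hl]; exact h4 hl
      · intro _ m hm hm'
        dsimp only at *
        rw [trunc_of_level_le (by omega)]
        exact ⟨hwS, hA⟩
      · intro u hu
        simp at hu

/-- The tree unravelling the open set `{x | ∃ n, x.node n ∈ D}`. -/
noncomputable def decoratedTree (T : GameTree.{u}) (N : ℕ) (hN : N % 2 = 0) (D : Set T.Node) :
    GameTree.{u} where
  Node := {p : T.Node × Set T.Node × Option T.Node // Valid N D p}
  level p := T.level p.1.1
  parent p := ⟨decorate N (T.parent p.1.1) p.1.2.1 p.1.2.2, p.2.parent⟩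
  root := ⟨decorate N T.root Set.univ none, valid_of_level_le (by rw [T.level_root]; omega) _ _⟩
  level_parent p := T.level_parent _
  level_root := T.level_root
  eq_root := by
    rintro ⟨⟨v, S, r⟩, h⟩ hv
    dsimp only at hv
    obtain rfl := T.eq_root v hv
    have h1 := h.low_set (by dsimp only; omega)
    have h2 := h.low_goal (by dsimp only; omega)
    dsimp only at h1 h2
    subst h1 h2
    exact Subtype.ext (by simp [decorate])
  exists_child p := by
    obtain ⟨q, hq, hl, hp⟩ := p.2.exists_child hN
    exact ⟨⟨q, hq⟩, hl, Subtype.ext hp⟩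

variable {hN : N % 2 = 0}

theorem decorated_child {p q : (decoratedTree T N hN D).Node}
    (h : (decoratedTree T N hN D).IsChild p q) :
    T.IsChild p.1.1 q.1.1 ∧ (N + 1 ≤ T.level p.1.1 → q.1.2.1 = p.1.2.1) ∧
      (N + 2 ≤ T.level p.1.1 → q.1.2.2 = p.1.2.2) := by
  obtain ⟨h1, rfl⟩ := h
  refine ⟨⟨h1, rfl⟩, fun h => ?_, fun h => ?_⟩
  · exact (if_neg (by simp only [decoratedTree, decorate] at h; omega)).symm
  · exact (if_neg (by simp only [decoratedTree, decorate] at h; omega)).symm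

/-- To lift a branch of `T`, one pair `(S, r)` is chosen for the whole branch and erased at low
levels. -/
theorem valid_decorate_branch {S : Set T.Node} {r : Option T.Node} (x : T.Branch) (n : ℕ)
    (hS : IsQuasiStrategy S) (ha : x.node (N + 1) ∈ S)
    (h0 : r = none → ∀ m, N + 2 ≤ m → m ≤ n →
      x.node m ∈ S ∧ x.node m ∉ (attractorIn D S).carrier)
    (h1 : ∀ u, r = some u → u ∈ D ∩ S ∧ ∃ m, N + 2 ≤ m ∧ u = x.node m) :
    Valid N D (decorate N (x.node n) S r) := by
  have hl := x.level_node n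
  rcases Nat.lt_or_ge N n with hn | hn
  swap
  · exact valid_of_level_le (by omega) _ _
  have e : decorate N (x.node n) S r = (x.node n, S, if n ≤ N + 1 then none else r) := by
    rw [decorate, if_neg (by omega), hl]
  rw [e]
  constructor
  · exact hS
  · exact fun h => absurd h (by dsimp only; omega)
  · exact fun h => if_pos (by dsimp only at h; omega)
  · intro _
    rw [x.trunc_node hn]
    exact ha
  · intro hr m hm hm'
    dsimp only at *
    rw [if_neg (by omega)] at hr
    rw [x.trunc_node (by omega)]
    exact h0 hr m hm (by omega)
  · intro u hu
    dsimp only at *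
    have hn' : ¬ n ≤ N + 1 := fun h => by simp [h] at hu
    rw [if_neg hn'] at hu
    obtain ⟨hu', m, hm, rfl⟩ := h1 u hu
    refine ⟨hu', by rwa [x.level_node], fun k hk hk' => ?_⟩
    rw [x.level_node] at hk hk'
    rw [x.trunc_node hk, x.trunc_node hk']

/-- The branch `x` with constant decorations. -/
noncomputable def decoratedBranch {hN : N % 2 = 0} (x : T.Branch) (S : Set T.Node)
    (r : Option T.Node) (h : ∀ n, Valid N D (decorate N (x.node n) S r)) :
    (decoratedTree T N hN D).Branch where
  node n := ⟨decorate N (x.node n) S r, h n⟩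
  level_node n := x.level_node n
  parent_node n := by
    refine Subtype.ext ?_
    simp only [decoratedTree, decorate, x.parent_node, x.level_node]
    refine Prod.ext rfl (Prod.ext ?_ ?_) <;> dsimp only <;> split_ifs <;> first | rfl | omega

/-- Decorations are chosen only in the moves at levels `N` and `N + 1`, so apart from the moves in
`T` only these two choices have to be compared with `s`. -/
theorem follows_decoratedBranch {x : T.Branch} {S : Set T.Node} {r : Option T.Node}
    {h : ∀ n, Valid N D (decorate N (x.node n) S r)} {i : Fin 2}
    {s : (decoratedTree T N hN D).Strategy}
    (hs : ∀ n, n % 2 = i.val → (s.next ⟨_, h n⟩).1.1 = x.node (n + 1) ∧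
      (n = N → (s.next ⟨_, h n⟩).1.2.1 = S) ∧ (n = N + 1 → (s.next ⟨_, h n⟩).1.2.2 = r)) :
    Follows i s (decoratedBranch (hN := hN) x S r h) := by
  intro n hn
  obtain ⟨e1, e2, e3⟩ := hs n hn
  obtain ⟨c1, c2, c3⟩ := decorated_child (s.isChild ⟨_, h n⟩)
  have hl := x.level_node n
  have hl' := x.level_node (n + 1)
  have hv := (s.next ⟨_, h n⟩).2
  change (⟨decorate N (x.node (n + 1)) S r, h (n + 1)⟩ : (decoratedTree T N hN D).Node) =
    s.next ⟨decorate N (x.node n) S r, h n⟩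
  refine Subtype.ext (Prod.ext e1.symm (Prod.ext ?_ ?_))
  · change (if T.level (x.node (n + 1)) ≤ N then Set.univ else S) = _
    by_cases hlow : n + 1 ≤ N
    · rw [if_pos (by omega), hv.low_set (by rw [e1]; omega)]
    · rw [if_neg (by omega)]
      by_cases hnN : n = N
      · exact (e2 hnN).symm
      · rw [c2 (by change N + 1 ≤ T.level (x.node n); omega)]
        exact (if_neg (by omega)).symm
  · change (if T.level (x.node (n + 1)) ≤ N + 1 then none else r) = _
    by_cases hlow : n + 1 ≤ N + 1
    · rw [if_pos (by omega), hv.low_goal (by rw [e1]; omega)]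
    · rw [if_neg (by omega)]
      by_cases hnN : n = N + 1
      · exact (e3 hnN).symm
      · rw [c3 (by change N + 2 ≤ T.level (x.node n); omega)]
        exact (if_neg (by omega)).symm

/-! ### Transfer of strategies -/

open Classical in
/-- The first ancestor of `v` in `X` of level at least `N + 2`. -/
noncomputable def firstIn (N : ℕ) (X : Set T.Node) (v : T.Node) : Option T.Node :=
  if h : ∃ m, N + 2 ≤ m ∧ m ≤ T.level v ∧ trunc v m ∈ X then some (trunc v (Nat.find h)) else none

theorem firstIn_eq_none {X : Set T.Node} {x : T.Branch} {n : ℕ}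
    (h : ∀ m, N + 2 ≤ m → m ≤ n → x.node m ∉ X) : firstIn N X (x.node n) = none := by
  refine dif_neg ?_
  rintro ⟨m, h1, h2, h3⟩
  rw [x.level_node] at h2
  rw [x.trunc_node h2] at h3
  exact h m h1 h2 h3

theorem firstIn_eq_some {X : Set T.Node} {x : T.Branch} {k n : ℕ} (hk : N + 2 ≤ k) (hkn : k ≤ n)
    (hX : x.node k ∈ X) (h : ∀ m, N + 2 ≤ m → m < k → x.node m ∉ X) :
    firstIn N X (x.node n) = some (x.node k) := by
  classical
  have hex : ∃ m, N + 2 ≤ m ∧ m ≤ T.level (x.node n) ∧ trunc (x.node n) m ∈ X :=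
    ⟨k, hk, by rwa [x.level_node], by rwa [x.trunc_node hkn]⟩
  have hf : Nat.find hex = k := by
    refine (Nat.find_eq_iff hex).2 ⟨⟨hk, by rwa [x.level_node], by rwa [x.trunc_node hkn]⟩, ?_⟩
    rintro m hm ⟨h1, -, h3⟩
    rw [x.trunc_node (by omega)] at h3
    exact h m h1 hm h3
  refine (dif_pos hex).trans ?_
  rw [hf, x.trunc_node hkn]

open Classical in
/-- The move of `s` at the node `v` with decorations `S` and `r`. -/
noncomputable def moveWith (s : (decoratedTree T N hN D).Strategy) (v : T.Node) (S : Set T.Node)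
    (r : Option T.Node) : T.Node :=
  if h : Valid N D (decorate N v S r) then (s.next ⟨_, h⟩).1.1
  else (Classical.arbitrary T.Strategy).next v

theorem moveWith_of_valid (s : (decoratedTree T N hN D).Strategy) {v : T.Node} {S : Set T.Node}
    {r : Option T.Node} (h : Valid N D (decorate N v S r)) :
    moveWith s v S r = (s.next ⟨_, h⟩).1.1 := dif_pos h

theorem isChild_moveWith (s : (decoratedTree T N hN D).Strategy) (v : T.Node) (S : Set T.Node)
    (r : Option T.Node) : T.IsChild v (moveWith s v S r) := by
  unfold moveWith
  split_ifs with h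
  · exact (decorated_child (s.isChild ⟨_, h⟩)).1
  · exact (Classical.arbitrary T.Strategy).isChild v

theorem moveWith_agree {n : ℕ} {s s' : (decoratedTree T N hN D).Strategy} (h : AgreeUpTo n s s')
    {v : T.Node} (hv : T.level v ≤ n) (S : Set T.Node) (r : Option T.Node) :
    moveWith s v S r = moveWith s' v S r := by
  unfold moveWith
  split_ifs with h'
  · rw [h ⟨_, h'⟩ hv]
  · rfl

open Classical in
/-- The move at `v` after a quasi-strategy has been fixed: once the play has visited a node `u`
of `X`, copy `s` with the decorations `g u` and `u`; before that, move to `X` if possible, and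
otherwise copy `s` with the decoration `S`. -/
noncomputable def transferMove (s : (decoratedTree T N hN D).Strategy) {X : Set T.Node}
    {E : T.Node → T.Node → Prop} {own : T.Node → Prop} (A : Attractor E own X)
    (g : T.Node → Set T.Node) (S : Set T.Node) (v : T.Node) : T.Node :=
  match firstIn N X v with
  | some u => moveWith s v (g u) (some u)
  | none => if v ∈ A.carrier ∧ T.IsChild v (A.move v) then A.move v else moveWith s v S none

theorem isChild_transferMove (s : (decoratedTree T N hN D).Strategy) {X : Set T.Node}
    {E : T.Node → T.Node → Prop} {own : T.Node → Prop} (A : Attractor E own X)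
    (g : T.Node → Set T.Node) (S : Set T.Node) (v : T.Node) :
    T.IsChild v (transferMove s A g S v) := by
  unfold transferMove
  split
  · exact isChild_moveWith _ _ _ _
  · split_ifs with h
    · exact h.2
    · exact isChild_moveWith _ _ _ _

theorem transferMove_agree {n : ℕ} {s s' : (decoratedTree T N hN D).Strategy}
    (h : AgreeUpTo n s s') {v : T.Node} (hv : T.level v ≤ n) {X : Set T.Node}
    {E : T.Node → T.Node → Prop} {own : T.Node → Prop} (A : Attractor E own X)
    (g : T.Node → Set T.Node) (S : Set T.Node) :
    transferMove s A g S v = transferMove s' A g S v := by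
  simp only [transferMove, moveWith_agree h hv]

theorem transferMove_of_some {s : (decoratedTree T N hN D).Strategy} {X : Set T.Node}
    {E : T.Node → T.Node → Prop} {own : T.Node → Prop} {A : Attractor E own X}
    {g : T.Node → Set T.Node} {S : Set T.Node} {v u : T.Node} (h : firstIn N X v = some u) :
    transferMove s A g S v = moveWith s v (g u) (some u) := by
  simp only [transferMove, h]

theorem transferMove_of_mem {s : (decoratedTree T N hN D).Strategy} {X : Set T.Node}
    {E : T.Node → T.Node → Prop} {own : T.Node → Prop} {A : Attractor E own X}
    {g : T.Node → Set T.Node} {S : Set T.Node} {v : T.Node} (h : firstIn N X v = none)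
    (hv : v ∈ A.carrier) (hc : T.IsChild v (A.move v)) :
    transferMove s A g S v = A.move v := by
  simp only [transferMove, h]
  exact if_pos ⟨hv, hc⟩

theorem transferMove_of_notMem {s : (decoratedTree T N hN D).Strategy} {X : Set T.Node}
    {E : T.Node → T.Node → Prop} {own : T.Node → Prop} {A : Attractor E own X}
    {g : T.Node → Set T.Node} {S : Set T.Node} {v : T.Node} (h : firstIn N X v = none)
    (hv : v ∉ A.carrier) : transferMove s A g S v = moveWith s v S none := by
  simp only [transferMove, h]
  exact if_neg fun h => hv h.1

end GameTree

namespace GameTree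

variable {T : GameTree.{u}} {N : ℕ} {D : Set T.Node} {hN : N % 2 = 0}

/-- The quasi-strategy that `s` chooses for Player `0` below the ancestor of `v` at level `N`. -/
noncomputable def zeroSet (s : (decoratedTree T N hN D).Strategy) (v : T.Node) : Set T.Node :=
  (s.next ⟨decorate N (trunc v N) Set.univ none,
    valid_of_level_le (by rw [level_trunc]; omega) _ _⟩).1.2.1

open Classical in
/-- The transfer of strategies for Player `0`. -/
noncomputable def stratZero (s : (decoratedTree T N hN D).Strategy) : T.Strategy where
  next v := if T.level v ≤ N then moveWith s v Set.univ none else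
    transferMove s (attractorIn D (zeroSet s v)) (fun _ => zeroSet s v) (zeroSet s v) v
  isChild v := by
    split_ifs
    exacts [isChild_moveWith _ _ _ _, isChild_transferMove _ _ _ _ _]

theorem stratZero_agree {n : ℕ} {s s' : (decoratedTree T N hN D).Strategy}
    (h : AgreeUpTo n s s') : AgreeUpTo n (stratZero s) (stratZero s') := by
  intro v hv
  simp only [stratZero]
  split_ifs with hl
  · exact moveWith_agree h hv _ _
  · have e : zeroSet s v = zeroSet s' v := by
      refine congrArg (fun z => z.1.2.1) (h ⟨_, _⟩ ?_)
      change T.level (trunc v N) ≤ n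
      rw [level_trunc]
      omega
    rw [e]
    exact transferMove_agree h hv _ _ _

theorem decorate_of_level_le {v : T.Node} (h : T.level v ≤ N) (S : Set T.Node)
    (r : Option T.Node) : decorate N v S r = (v, Set.univ, none) := by
  rw [decorate, if_pos h, if_pos (by omega)]

theorem next_congr (s : (decoratedTree T N hN D).Strategy)
    {p q : T.Node × Set T.Node × Option T.Node} (h : p = q) (hp : Valid N D p) :
    s.next ⟨p, hp⟩ = s.next ⟨q, h ▸ hp⟩ := by
  subst h
  rfl

theorem moveWith_congr (s : (decoratedTree T N hN D).Strategy) {v : T.Node} {S S' : Set T.Node}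
    {r r' : Option T.Node} (h : decorate N v S r = decorate N v S' r') :
    moveWith s v S r = moveWith s v S' r' := by
  by_cases hv : Valid N D (decorate N v S r)
  · rw [moveWith_of_valid s hv, moveWith_of_valid s (h ▸ hv), next_congr s h]
  · have hv' : ¬ Valid N D (decorate N v S' r') := h ▸ hv
    unfold moveWith
    rw [dif_neg hv, dif_neg hv']

theorem zeroSet_branch (s : (decoratedTree T N hN D).Strategy) (x : T.Branch) {n : ℕ}
    (hn : N ≤ n) {S : Set T.Node} {r : Option T.Node}
    (h : Valid N D (decorate N (x.node N) S r)) :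
    zeroSet s (x.node n) = (s.next ⟨_, h⟩).1.2.1 := by
  have e : decorate N (trunc (x.node n) N) Set.univ none = decorate N (x.node N) S r := by
    rw [x.trunc_node hn, decorate_of_level_le (x.level_node N).le,
      decorate_of_level_le (x.level_node N).le]
  rw [zeroSet, next_congr s e]

theorem next_eq_of_low (s : (decoratedTree T N hN D).Strategy) (x : T.Branch) {n : ℕ}
    (hn : n ≤ N) (hx : x.node (n + 1) = moveWith s (x.node n) Set.univ none) {S : Set T.Node}
    {r : Option T.Node} (h : Valid N D (decorate N (x.node n) S r)) :
    (s.next ⟨_, h⟩).1.1 = x.node (n + 1) := by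
  have hl := x.level_node n
  rw [hx, moveWith_congr s (S' := S) (r' := r), moveWith_of_valid s h]
  rw [decorate_of_level_le (by omega), decorate_of_level_le (by omega)]

/-- Before the play has reached the goal `u`, there is only one move. -/
theorem next_eq_of_goal (s : (decoratedTree T N hN D).Strategy) (x : T.Branch) {n k : ℕ}
    {S : Set T.Node} (hk : n < k)
    (h : Valid N D (decorate N (x.node n) S (some (x.node k))))
    (hr : (s.next ⟨_, h⟩).1.2.2 = some (x.node k)) :
    (s.next ⟨_, h⟩).1.1 = x.node (n + 1) := by
  have hl : T.level (s.next ⟨_, h⟩).1.1 = n + 1 := by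
    rw [(decorated_child (s.isChild ⟨_, h⟩)).1.1]
    exact congrArg (· + 1) (x.level_node n)
  have e := ((s.next ⟨_, h⟩).2.goal _ hr).2.2 (n + 1) (by rw [x.level_node]; omega) hl.ge
  rw [x.trunc_node (by omega), trunc_of_level_le hl.le] at e
  exact e.symm

/-- The promise is built into the nodes of the decorated tree, so `s` cannot break it. -/
theorem next_mem_of_stay (s : (decoratedTree T N hN D).Strategy) (x : T.Branch) {n : ℕ}
    {S : Set T.Node} (hn : N + 1 ≤ n) (h : Valid N D (decorate N (x.node n) S none))
    (hx : (s.next ⟨_, h⟩).1.1 = x.node (n + 1)) (hr : (s.next ⟨_, h⟩).1.2.2 = none) :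
    x.node (n + 1) ∈ S ∧ x.node (n + 1) ∉ (attractorIn D S).carrier := by
  have hl := x.level_node (n + 1)
  have hS : (s.next ⟨_, h⟩).1.2.1 = S := by
    rw [(decorated_child (s.isChild ⟨_, h⟩)).2.1
      (by change N + 1 ≤ T.level (x.node n); rwa [x.level_node])]
    exact if_neg (by rw [x.level_node]; omega)
  have e := (s.next ⟨_, h⟩).2.stay hr (n + 1) (by omega) (by rw [hx]; omega)
  rwa [hS, hx, trunc_of_level_le hl.le] at e

/-- If the play meets `D ∩ S` from level `N + 2` on, its first such node is declared in retrospect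
to be the goal named by Player `1`: moves before it are forced, later ones are copied from `s`.
Otherwise the play never enters the attractor from that level on, since the attracting strategy
would lead to `D ∩ S`; so the promise was kept and all moves were copied from `s`. -/
theorem stratZero_lift (s : (decoratedTree T N hN D).Strategy) (x : T.Branch)
    (hx : Follows 0 (stratZero s) x) :
    ∃ x' : (decoratedTree T N hN D).Branch, Follows 0 s x' ∧ ∀ n, (x'.node n).1.1 = x.node n := by
  classical
  have hx : ∀ n, n % 2 = 0 → x.node (n + 1) = (stratZero s).next (x.node n) := hx
  have low : ∀ n, n % 2 = 0 → n ≤ N → ∀ S r (h : Valid N D (decorate N (x.node n) S r)),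
      (s.next ⟨_, h⟩).1.1 = x.node (n + 1) := by
    intro n hn hnN S r h
    refine next_eq_of_low s x hnN ?_ h
    rw [hx n hn]
    exact if_pos ((x.level_node n).trans_le hnN)
  have hv : Valid N D (decorate N (x.node N) Set.univ none) :=
    valid_of_level_le (x.level_node N).le _ _
  obtain ⟨S, hS⟩ : ∃ S, S = (s.next ⟨_, hv⟩).1.2.1 := ⟨_, rfl⟩
  have hz : ∀ n, N ≤ n → zeroSet s (x.node n) = S := fun n hn => by
    rw [hS, zeroSet_branch s x hn hv]
  have hSset : ∀ S' r (h : Valid N D (decorate N (x.node N) S' r)),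
      (s.next ⟨_, h⟩).1.2.1 = S := fun S' r h => by
    rw [← hz N le_rfl, zeroSet_branch s x le_rfl h]
  have hq : IsQuasiStrategy S := hS ▸ (s.next ⟨_, hv⟩).2.quasi
  have ha : x.node (N + 1) ∈ S := by
    have h1 := low N hN le_rfl _ _ hv
    have h2 := (s.next ⟨_, hv⟩).2.mem (by rw [h1, x.level_node])
    rwa [h1, trunc_of_level_le (x.level_node _).le, ← hS] at h2
  have high : ∀ n, n % 2 = 0 → N < n → x.node (n + 1) =
      transferMove s (attractorIn D S) (fun _ => S) S (x.node n) := by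
    intro n hn hnN
    have hl := x.level_node n
    rw [hx n hn]
    refine (if_neg (by omega)).trans ?_
    rw [hz n hnN.le]
  by_cases hex : ∃ k, N + 2 ≤ k ∧ x.node k ∈ D ∩ S
  · have hk := Nat.find_spec hex
    have hmin : ∀ m, N + 2 ≤ m → m < Nat.find hex → x.node m ∉ D ∩ S :=
      fun m h1 h2 h3 => Nat.find_min hex h2 ⟨h1, h3⟩
    generalize Nat.find hex = k at hk hmin
    have hval := fun n => valid_decorate_branch (N := N) (D := D) (r := some (x.node k)) x n hq ha
      (fun h => by simp at h) (fun u hu => by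
        obtain rfl := Option.some.inj hu
        exact ⟨hk.2, k, hk.1, rfl⟩)
    refine ⟨decoratedBranch x S _ hval, follows_decoratedBranch fun n hn => ?_, fun n => rfl⟩
    replace hn : n % 2 = 0 := hn
    refine ⟨?_, ?_, by omega⟩
    · rcases Nat.lt_or_ge N n with hnN | hnN
      swap
      · exact low n hn hnN _ _ _
      rcases Nat.lt_or_ge n k with hnk | hnk
      · refine next_eq_of_goal s x hnk _ ?_
        rw [(decorated_child (s.isChild ⟨_, hval n⟩)).2.2
          (by change N + 2 ≤ T.level (x.node n); rw [x.level_node]; omega)]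
        exact if_neg (by rw [x.level_node]; omega)
      · rw [high n hn hnN, transferMove_of_some (firstIn_eq_some hk.1 hnk hk.2 hmin),
          moveWith_of_valid s (hval n)]
    · rintro rfl
      exact hSset _ _ _
  · push Not at hex
    have hnone : ∀ n, firstIn N (D ∩ S) (x.node n) = none := fun n =>
      firstIn_eq_none fun m hm _ => hex m hm
    have key : ∀ n, N + 2 ≤ n → x.node n ∈ S ∧ x.node n ∉ (attractorIn D S).carrier := by
      have hodd : ∀ n, n % 2 = 1 → x.node n ∈ S → x.node (n + 1) ∈ S := fun n hn h =>
        (hq _ h).1 (by rwa [x.level_node]) _ (x.isChild n)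
      set C := attractorIn D S
      have hmove : ∀ n, n % 2 = 0 → N + 2 ≤ n → x.node n ∈ C.carrier →
          x.node (n + 1) = C.move (x.node n) := by
        intro n hn hnN hC
        rw [high n hn (by omega), transferMove_of_mem (hnone n) hC
          (C.move_spec _ hC (hex n hnN) (by rwa [x.level_node])).1.1]
      -- The play stays in `S`: Player `1` cannot leave a quasi-strategy, attracting moves lie in
      -- `S`, and before the attractor is entered the moves of `s` respect the promise.
      have main : ∀ n, N + 1 ≤ n → x.node n ∈ S ∧ (N + 2 ≤ n ∧ x.node n ∈ C.carrier ∨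
          ∀ m, N + 2 ≤ m → m ≤ n → x.node m ∈ S ∧ x.node m ∉ C.carrier) := by
        intro n hn
        induction n, hn using Nat.le_induction with
        | base => exact ⟨ha, Or.inr fun m h1 h2 => by omega⟩
        | succ n hn ih =>
          obtain ⟨hnS, ⟨hn2, hC⟩ | hC⟩ := ih
          · have hev : n % 2 = 0 → x.node (n + 1) ∈ S ∧ x.node (n + 1) ∈ C.carrier := by
              intro h
              have hs := C.move_spec _ hC (hex n hn2) (by rwa [x.level_node])
              rw [hmove n h hn2 hC]
              exact ⟨hs.1.2, hs.2.1⟩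
            rcases Nat.mod_two_eq_zero_or_one n with h | h
            · exact ⟨(hev h).1, Or.inl ⟨by omega, (hev h).2⟩⟩
            · exact ⟨hodd n h hnS, Or.inl ⟨by omega, (C.opp_spec _ hC (hex n hn2)
                (by rw [x.level_node]; omega) _ ⟨x.isChild n, hodd n h hnS⟩).1⟩⟩
          · have hS' : x.node (n + 1) ∈ S := by
              rcases Nat.mod_two_eq_zero_or_one n with h | h
              · have hval := valid_decorate_branch (N := N) (D := D) (r := none) x n hq ha
                  (fun _ => hC) (fun u hu => by simp at hu)
                refine (next_mem_of_stay s x hn hval ?_ ?_).1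
                · rw [high n h (by omega), transferMove_of_notMem (hnone n)
                    (hC n (by omega) le_rfl).2, moveWith_of_valid s hval]
                · rw [(decorated_child (s.isChild ⟨_, hval⟩)).2.2
                    (by change N + 2 ≤ T.level (x.node n); rw [x.level_node]; omega)]
                  exact ite_self none
              · exact hodd n h hnS
            refine ⟨hS', ?_⟩
            by_cases h : x.node (n + 1) ∈ C.carrier
            · exact Or.inl ⟨by omega, h⟩
            · refine Or.inr fun m h1 h2 => ?_
              rcases Nat.lt_or_ge n m with hnm | hnm
              · obtain rfl : m = n + 1 := by omega
                exact ⟨hS', h⟩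
              · exact hC m h1 hnm
      refine fun n hn => ⟨(main n (by omega)).1, fun hC => ?_⟩
      obtain ⟨k, hk, hk'⟩ := C.reaches x.node n hC
        (fun m hm h1 _ h3 => hmove m (by rwa [x.level_node] at h3) (by omega) h1)
        (fun m hm _ _ h3 => ⟨x.isChild m, (main (m + 1) (by omega)).1⟩)
      exact hex k (by omega) hk'
    have hval := fun n => valid_decorate_branch (N := N) (D := D) (r := none) x n hq ha
      (fun _ m hm _ => key m hm) (fun u hu => by simp at hu)
    refine ⟨decoratedBranch x S _ hval, follows_decoratedBranch fun n hn => ?_, fun n => rfl⟩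
    replace hn : n % 2 = 0 := hn
    refine ⟨?_, ?_, by omega⟩
    · rcases Nat.lt_or_ge N n with hnN | hnN
      swap
      · exact low n hn hnN _ _ _
      rw [high n hn hnN, transferMove_of_notMem (hnone n) (key n (by omega)).2,
        moveWith_of_valid s (hval n)]
    · rintro rfl
      exact hSset _ _ _

/-- The node `u` is the goal with which `s` answers to the quasi-strategy `S` at the node `a`. -/
def Answers (s : (decoratedTree T N hN D).Strategy) (a u : T.Node) (S : Set T.Node) : Prop :=
  ∃ h : Valid N D (decorate N a S none), (s.next ⟨_, h⟩).1.2.2 = some u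

/-- The move against an opponent for whom the possible goals are given by `K`. -/
noncomputable def answerMove (s : (decoratedTree T N hN D).Strategy)
    (K : T.Node → Set T.Node → Prop) (v : T.Node) : T.Node :=
  transferMove s (attractorOne {u | ∃ S, K u S}) (fun u => Classical.epsilon (K u))
    (attractorOne {u | ∃ S, K u S}).carrierᶜ v

open Classical in
/-- The transfer of strategies for Player `1`. -/
noncomputable def stratOne (s : (decoratedTree T N hN D).Strategy) : T.Strategy where
  next v := if T.level v ≤ N then moveWith s v Set.univ none else
    answerMove s (Answers s (trunc v (N + 1))) v
  isChild v := by
    split_ifs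
    exacts [isChild_moveWith _ _ _ _, isChild_transferMove _ _ _ _ _]

theorem stratOne_agree {n : ℕ} {s s' : (decoratedTree T N hN D).Strategy}
    (h : AgreeUpTo n s s') : AgreeUpTo n (stratOne s) (stratOne s') := by
  intro v hv
  simp only [stratOne]
  split_ifs with hl
  · exact moveWith_agree h hv _ _
  · have e : Answers s (trunc v (N + 1)) = Answers s' (trunc v (N + 1)) := by
      funext u S
      refine propext (exists_congr fun hval => ?_)
      have : T.level (trunc v (N + 1)) ≤ n := by
        rw [level_trunc]
        omega
      rw [h ⟨_, hval⟩ this]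
    rw [e]
    exact transferMove_agree h hv _ _ _

theorem Answers.spec {s : (decoratedTree T N hN D).Strategy} {a u : T.Node} {S : Set T.Node}
    (h : Answers s a u S) (ha : T.level a = N + 1) :
    IsQuasiStrategy S ∧ a ∈ S ∧ u ∈ D ∩ S ∧ N + 2 ≤ T.level u := by
  obtain ⟨hv, hu⟩ := h
  have hS : (decorate N a S none).2.1 = S := if_neg (by omega)
  have hz : (s.next ⟨_, hv⟩).1.2.1 = S :=
    ((decorated_child (s.isChild ⟨_, hv⟩)).2.1 ha.ge).trans hS
  have hm := hv.mem ha.ge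
  have hg := (s.next ⟨_, hv⟩).2.goal u hu
  have hq := hv.quasi
  rw [hS] at hq hm
  rw [hz] at hg
  exact ⟨hq, by rwa [decorate, trunc_of_level_le ha.le] at hm, hg.1, hg.2.1⟩

/-- If the play meets a node `u` with which `s` answers some quasi-strategy, then in retrospect
Player `0` chose such a quasi-strategy and `u` was the goal. Otherwise the play stays outside Player
`1`'s attractor of these nodes. The complement `S` of that attractor is a quasi-strategy which `s`
cannot answer with a goal, as the goal would lie both in `S` and in the attractor. Hence `s` gives
the promise, and its moves can be copied. -/
theorem stratOne_lift (s : (decoratedTree T N hN D).Strategy) (x : T.Branch)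
    (hx : Follows 1 (stratOne s) x) :
    ∃ x' : (decoratedTree T N hN D).Branch, Follows 1 s x' ∧ ∀ n, (x'.node n).1.1 = x.node n := by
  classical
  have hx : ∀ n, n % 2 = 1 → x.node (n + 1) = (stratOne s).next (x.node n) := hx
  have low : ∀ n, n % 2 = 1 → n ≤ N → ∀ S r (h : Valid N D (decorate N (x.node n) S r)),
      (s.next ⟨_, h⟩).1.1 = x.node (n + 1) := by
    intro n hn hnN S r h
    refine next_eq_of_low s x hnN ?_ h
    rw [hx n hn]
    exact if_pos ((x.level_node n).trans_le hnN)
  have hla := x.level_node (N + 1)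
  obtain ⟨K, hK⟩ : ∃ K, K = Answers s (x.node (N + 1)) := ⟨_, rfl⟩
  have hspec : ∀ {u S}, K u S → _ := fun {u S} h =>
    (hK ▸ h : Answers s (x.node (N + 1)) u S).spec hla
  have high : ∀ n, n % 2 = 1 → N < n → x.node (n + 1) = answerMove s K (x.node n) := by
    intro n hn hnN
    have hl := x.level_node n
    rw [hx n hn]
    refine (if_neg (by omega)).trans ?_
    rw [x.trunc_node hnN, hK]
  by_cases hex : ∃ k, N + 2 ≤ k ∧ x.node k ∈ {u | ∃ S, K u S}
  · have hk := Nat.find_spec hex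
    have hmin : ∀ m, N + 2 ≤ m → m < Nat.find hex → x.node m ∉ {u | ∃ S, K u S} :=
      fun m h1 h2 h3 => Nat.find_min hex h2 ⟨h1, h3⟩
    generalize Nat.find hex = k at hk hmin
    obtain ⟨S, hS⟩ : ∃ S, S = Classical.epsilon (K (x.node k)) := ⟨_, rfl⟩
    have hKS : K (x.node k) S := hS ▸ Classical.epsilon_spec hk.2
    obtain ⟨hq, ha, hu, -⟩ := hspec hKS
    have hval := fun n => valid_decorate_branch (N := N) (D := D) (r := some (x.node k)) x n hq ha
      (fun h => by simp at h) (fun u hu' => by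
        obtain rfl := Option.some.inj hu'
        exact ⟨hu, k, hk.1, rfl⟩)
    -- At level `N + 1` the goal is not yet part of the decoration, so this is the node at which
    -- `Answers` consults `s`.
    have hfirst : (s.next ⟨_, hval (N + 1)⟩).1.2.2 = some (x.node k) := by
      rw [hK] at hKS
      obtain ⟨h, hr⟩ := hKS
      have e : decorate N (x.node (N + 1)) S (some (x.node k)) =
          decorate N (x.node (N + 1)) S none := by
        simp [decorate, hla]
      rw [next_congr s e]
      exact hr
    refine ⟨decoratedBranch x S _ hval, follows_decoratedBranch fun n hn => ?_, fun n => rfl⟩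
    replace hn : n % 2 = 1 := hn
    refine ⟨?_, by omega, ?_⟩
    · rcases Nat.lt_or_ge N n with hnN | hnN
      swap
      · exact low n hn hnN _ _ _
      rcases Nat.lt_or_ge n k with hnk | hnk
      · refine next_eq_of_goal s x hnk _ ?_
        rcases Nat.lt_or_ge (N + 1) n with hnN' | hnN'
        · rw [(decorated_child (s.isChild ⟨_, hval n⟩)).2.2
            (by change N + 2 ≤ T.level (x.node n); rw [x.level_node]; omega)]
          exact if_neg (by rw [x.level_node]; omega)
        · obtain rfl : n = N + 1 := by omega
          exact hfirst
      · rw [high n hn hnN, answerMove,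
          transferMove_of_some (firstIn_eq_some hk.1 hnk hk.2 hmin), ← hS,
          moveWith_of_valid s (hval n)]
    · rintro rfl
      exact hfirst
  · push Not at hex
    set C := attractorOne {u | ∃ S, K u S} with hC
    have hnone : ∀ n, firstIn N {u | ∃ S, K u S} (x.node n) = none := fun n =>
      firstIn_eq_none fun m hm _ => hex m hm
    have hex' : ∀ n, N + 1 ≤ n → x.node n ∉ {u | ∃ S, K u S} := by
      rintro n hn ⟨S, h⟩
      have hl := (hspec h).2.2.2
      rw [x.level_node] at hl
      exact hex n hl ⟨S, h⟩
    have hnot : ∀ n, N + 1 ≤ n → x.node n ∉ C.carrier := by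
      intro n hn h
      obtain ⟨k, hk, hk'⟩ := C.reaches x.node n h
        (fun m hm h1 h2 h3 => by
          rw [high m (by rwa [x.level_node] at h3) (by omega)]
          exact transferMove_of_mem (hnone m) h1 (C.move_spec _ h1 h2 h3).1)
        (fun m _ _ _ _ => x.isChild m)
      exact hex' k (by omega) hk'
    obtain ⟨S, hS⟩ : ∃ S, S = C.carrierᶜ := ⟨_, rfl⟩
    have hq : IsQuasiStrategy S := hS ▸ isQuasiStrategy_compl_attractorOne _
    have hmem : ∀ n, N + 1 ≤ n → x.node n ∈ S := fun n hn => hS ▸ hnot n hn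
    have ha := hmem (N + 1) le_rfl
    have hfirst : ∀ h : Valid N D (decorate N (x.node (N + 1)) S none),
        (s.next ⟨_, h⟩).1.2.2 = none := by
      intro h
      by_contra hne
      obtain ⟨u, hu⟩ := Option.ne_none_iff_exists'.1 hne
      have hKu : K u S := hK ▸ ⟨h, hu⟩
      have huS := (hspec hKu).2.2.1.2
      rw [hS] at huS
      exact huS (C.subset ⟨S, hKu⟩)
    have hgoal : ∀ n, n % 2 = 1 → N + 1 ≤ n → ∀ h : Valid N D (decorate N (x.node n) S none),
        (s.next ⟨_, h⟩).1.2.2 = none := by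
      intro n hn hnN h
      rcases Nat.lt_or_ge (N + 1) n with hnN' | hnN'
      · rw [(decorated_child (s.isChild ⟨_, h⟩)).2.2
          (by change N + 2 ≤ T.level (x.node n); rw [x.level_node]; omega)]
        exact ite_self none
      · obtain rfl : n = N + 1 := by omega
        exact hfirst h
    have hnext : ∀ n, n % 2 = 1 → ∀ h : Valid N D (decorate N (x.node n) S none),
        (s.next ⟨_, h⟩).1.1 = x.node (n + 1) := by
      intro n hn h
      rcases Nat.lt_or_ge N n with hnN | hnN
      swap
      · exact low n hn hnN _ _ _
      rw [high n hn hnN, answerMove, transferMove_of_notMem (hnone n) (hnot n hnN), ← hC, ← hS,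
        moveWith_of_valid s h]
    have main : ∀ n, N + 1 ≤ n → ∀ m, N + 2 ≤ m → m ≤ n →
        x.node m ∈ S ∧ x.node m ∉ (attractorIn D S).carrier := by
      intro n hn
      induction n, hn using Nat.le_induction with
      | base => exact fun m h1 h2 => by omega
      | succ n hn ih =>
        intro m h1 h2
        rcases Nat.lt_or_ge n m with hnm | hnm
        swap
        · exact ih m h1 hnm
        obtain rfl : m = n + 1 := by omega
        rcases Nat.mod_two_eq_zero_or_one n with h | h
        · exact ⟨hmem _ (by omega), (attractorIn D S).own_compl _ (ih n (by omega) le_rfl).2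
            (by rwa [x.level_node]) _ ⟨x.isChild n, hmem _ (by omega)⟩⟩
        · have hval := valid_decorate_branch (N := N) (D := D) (r := none) x n hq ha
            (fun _ => ih) (fun u hu => by simp at hu)
          exact next_mem_of_stay s x hn hval (hnext n h hval) (hgoal n h hn hval)
    have hval := fun n => valid_decorate_branch (N := N) (D := D) (r := none) x n hq ha
      (fun _ m hm _ => main m (by omega) m hm le_rfl) (fun u hu => by simp at hu)
    refine ⟨decoratedBranch x S _ hval, follows_decoratedBranch fun n hn => ?_, fun n => rfl⟩
    replace hn : n % 2 = 1 := hn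
    refine ⟨hnext n hn (hval n), by omega, ?_⟩
    rintro rfl
    exact hfirst _

/-! ### The covering by the decorated tree -/

variable (T N hN D) in
/-- The decorated tree covers the original one. -/
noncomputable def decoratedCover : Cover N (decoratedTree T N hN D) T where
  map p := p.1.1
  level_map _ := rfl
  parent_map _ := rfl
  injective := by
    rintro ⟨⟨v, S, r⟩, hv⟩ ⟨⟨w, S', r'⟩, hw⟩ (hl : T.level v ≤ N) (hl' : T.level w ≤ N)
      (rfl : v = w)
    obtain rfl : S = Set.univ := hv.low_set hl
    obtain rfl : S' = Set.univ := hw.low_set hl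
    obtain rfl : r = none := hv.low_goal (by dsimp only; omega)
    obtain rfl : r' = none := hw.low_goal (by dsimp only; omega)
    rfl
  surjective v hv := ⟨⟨_, valid_of_level_le hv Set.univ none⟩, rfl⟩
  strat := ![stratZero, stratOne]
  agree i n s s' h := by
    fin_cases i
    exacts [stratZero_agree h, stratOne_agree h]
  strat_map i s p hp := by
    obtain ⟨⟨v, S, r⟩, hv⟩ := p
    replace hp : T.level v < N := hp
    have e : decorate N v Set.univ none = (v, S, r) := by
      have h1 := hv.low_set hp.le
      have h2 := hv.low_goal (by dsimp only; omega)
      dsimp only at h1 h2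
      rw [decorate_of_level_le hp.le, h1, h2]
    have hm : moveWith s v Set.univ none = (s.next ⟨(v, S, r), hv⟩).1.1 := by
      rw [moveWith_of_valid s (e ▸ hv), next_congr s e]
    fin_cases i
    exacts [(if_pos hp.le).trans hm, (if_pos hp.le).trans hm]
  lift i s x hx := by
    fin_cases i
    exacts [stratZero_lift s x hx, stratOne_lift s x hx]

/-- The answer stored at level `N + 2` decides membership. A goal is a node of `D` on the branch;
without a goal the branch stays in `S` outside the attractor of `D ∩ S`. As `D` is closed under
children, meeting `D` anywhere would mean meeting it at these levels. -/
theorem isClopenSet_decorated (hD : ∀ v w, T.IsChild v w → v ∈ D → w ∈ D) :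
    IsClopenSet {x : (decoratedTree T N hN D).Branch | ∃ n, (x.node n).1.1 ∈ D} := by
  have hup : ∀ (x : (decoratedTree T N hN D).Branch) m n, m ≤ n → (x.node m).1.1 ∈ D →
      (x.node n).1.1 ∈ D := by
    intro x m n h hm
    induction n, h using Nat.le_induction with
    | base => exact hm
    | succ n _ ih => exact hD _ _ (decorated_child (x.isChild n)).1 ih
  have hl : ∀ (x : (decoratedTree T N hN D).Branch) n, T.level (x.node n).1.1 = n :=
    fun x n => x.level_node n
  have hgoal : ∀ (x : (decoratedTree T N hN D).Branch) n, N + 2 ≤ n →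
      (x.node n).1.2.2 = (x.node (N + 2)).1.2.2 := by
    intro x n h
    induction n, h using Nat.le_induction with
    | base => rfl
    | succ n h ih => rw [(decorated_child (x.isChild n)).2.2 (by rwa [hl]), ih]
  have key : ∀ x : (decoratedTree T N hN D).Branch, (∃ n, (x.node n).1.1 ∈ D) ↔
      (x.node (N + 2)).1.2.2 ≠ none := by
    intro x
    constructor
    · rintro ⟨n, hn⟩ hr
      have h1 := hup x n (n + (N + 2)) (by omega) hn
      have h2 := (x.node (n + (N + 2))).2.stay (by rw [hgoal x _ (by omega), hr])
        (n + (N + 2)) (by omega) (hl _ _).ge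
      rw [trunc_of_level_le (hl _ _).le] at h2
      exact h2.2 ((attractorIn D _).subset ⟨h1, h2.1⟩)
    · intro hr
      obtain ⟨u, hu⟩ := Option.ne_none_iff_exists'.1 hr
      have hg := (x.node (N + 2)).2.goal u hu
      have hg' := (x.node (T.level u)).2.goal u (by rw [hgoal x _ hg.2.1, hu])
      refine ⟨T.level u, ?_⟩
      have e := hg'.2.2 _ le_rfl (hl _ _).ge
      rw [trunc_of_level_le le_rfl, trunc_of_level_le (hl _ _).le] at e
      rw [← e]
      exact hg.1.1
  constructor
  · intro x hx
    refine ⟨N + 2, fun y hy => (key y).2 ?_⟩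
    rw [hy]
    exact (key x).1 hx
  · intro x hx
    refine ⟨N + 2, fun y hy h => hx ((key x).2 ?_)⟩
    rw [← hy]
    exact (key y).1 h

theorem Continuous.comp {L : Type v} {T' : GameTree.{u}} {f : T.Branch → ℕ → L}
    (hf : Continuous f) (c : Cover N T' T) : Continuous (f ∘ c.branchMap) := by
  intro x n
  obtain ⟨m, hm⟩ := hf (c.branchMap x) n
  exact ⟨m, fun y hy => hm _ (congrArg c.map hy)⟩

theorem IsOpenSet.preimage {T' : GameTree.{u}} {A : Set T.Branch} (hA : IsOpenSet A)
    {f : T'.Branch → T.Branch} (hf : ∀ x y n, x.node n = y.node n → (f x).node n = (f y).node n) :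
    IsOpenSet (f ⁻¹' A) := by
  intro x hx
  obtain ⟨n, hn⟩ := hA (f x) hx
  exact ⟨n, fun y hy => hn _ (hf y x n hy)⟩

theorem IsClopenSet.preimage {T' : GameTree.{u}} {A : Set T.Branch} (hA : IsClopenSet A)
    {f : T'.Branch → T.Branch} (hf : ∀ x y n, x.node n = y.node n → (f x).node n = (f y).node n) :
    IsClopenSet (f ⁻¹' A) :=
  ⟨hA.1.preimage hf, hA.2.preimage hf⟩

theorem IsClopenSet.compl {A : Set T.Branch} (hA : IsClopenSet A) : IsClopenSet Aᶜ :=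
  ⟨hA.2, by rw [compl_compl]; exact hA.1⟩

/-- Open sets can be unravelled. -/
theorem IsOpenSet.exists_cover {A : Set T.Branch} (hA : IsOpenSet A) (N : ℕ) :
    ∃ (T' : GameTree.{u}) (c : Cover N T' T), IsClopenSet (c.branchMap ⁻¹' A) := by
  let D : Set T.Node := {v | ∀ x : T.Branch, x.node (T.level v) = v → x ∈ A}
  have hD : ∀ v w, T.IsChild v w → v ∈ D → w ∈ D := by
    intro v w hw hv x hx
    refine hv x ?_
    rw [hw.1] at hx
    rw [← x.parent_node, hx, hw.2]
  have e : A = {x | ∃ n, x.node n ∈ D} := by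
    ext x
    constructor
    · intro hx
      obtain ⟨n, hn⟩ := hA x hx
      exact ⟨n, fun y hy => hn y (by rwa [x.level_node] at hy)⟩
    · rintro ⟨n, hn⟩
      exact hn x (by rw [x.level_node])
  -- The construction needs an even level; fixing more levels than required is harmless.
  have h2 : 2 * N % 2 = 0 := by omega
  refine ⟨_, (decoratedCover T (2 * N) D h2).mono (by omega), ?_⟩
  have h := isClopenSet_decorated (N := 2 * N) (hN := h2) hD
  rw [e]
  exact h

end GameTree

namespace GameTree

/-! ### Determinacy -/

/-- Every continuous preimage of the set of words `A` in the branches of a tree can be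
unravelled. -/
def UniversallyUnravelled {L : Type v} (A : Set (ℕ → L)) : Prop :=
  ∀ (T : GameTree.{u}) (f : T.Branch → ℕ → L), Continuous f → ∀ N,
    ∃ (T' : GameTree.{u}) (c : Cover N T' T), IsClopenSet (c.branchMap ⁻¹' (f ⁻¹' A))

namespace UniversallyUnravelled

variable {L : Type v}

theorem compl {A : Set (ℕ → L)} (hA : UniversallyUnravelled.{u} A) :
    UniversallyUnravelled.{u} Aᶜ := fun T f hf N =>
  let ⟨T', c, hc⟩ := hA T f hf N
  ⟨T', c, hc.compl⟩

/-- Such a condition is clopen in every tree by continuity, so the identity covering will do. -/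
theorem coordinate (p : L → Prop) (n : ℕ) : UniversallyUnravelled.{u} {α : ℕ → L | p (α n)} := by
  intro T f hf N
  refine ⟨T, Cover.id N T, fun x hx => ?_, fun x hx => ?_⟩
  · obtain ⟨m, hm⟩ := hf x n
    refine ⟨m, fun y hy => ?_⟩
    have e := hm y hy
    change p (f y n)
    rw [e]
    exact hx
  · obtain ⟨m, hm⟩ := hf x n
    refine ⟨m, fun y hy h => hx ?_⟩
    have e := hm y hy
    change p (f x n)
    rw [← e]
    exact h

theorem const (p : Prop) : UniversallyUnravelled.{u} {_α : ℕ → L | p} :=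
  coordinate (fun _ => p) 0

/-- The `i`-th covering unravels the pullback of `A i` to the tree obtained so far, which is why the
invariant speaks of all trees and all continuous maps. The growing bounds `N + i` make the inverse
limit a covering. -/
theorem iUnion_nat {A : ℕ → Set (ℕ → L)} (hA : ∀ i, UniversallyUnravelled.{u} (A i)) :
    UniversallyUnravelled.{u} (⋃ i, A i) := by
  intro T f hf N
  let State := Σ T : GameTree.{u}, {f : T.Branch → ℕ → L // Continuous f}
  have hstep : ∀ i (S : State), ∃ (T' : GameTree.{u}) (c : Cover (N + i) T' S.1),
      IsClopenSet (c.branchMap ⁻¹' (S.2.1 ⁻¹' A i)) := fun i S => hA i S.1 S.2.1 S.2.2 (N + i)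
  choose next cov hcov using hstep
  let seq : ℕ → State := fun i =>
    Nat.rec ⟨T, f, hf⟩ (fun i S => ⟨next i S, S.2.1 ∘ (cov i S).branchMap, S.2.2.comp _⟩) i
  let Tr : ℕ → GameTree.{u} := fun i => (seq i).1
  let c : ∀ i, Cover (N + i) (Tr (i + 1)) (Tr i) := fun i => cov i (seq i)
  have hproj : ∀ i (x : (limit c).Branch),
      (c i).branchMap (limitProj (T := Tr) (c := c) (i + 1) x) = limitProj (T := Tr) (c := c) i x := by
    intro i x
    exact Branch.ext (funext fun n => (x.node n).2 i)
  have hf' : ∀ i (x : (limit c).Branch), (seq i).2.1 (limitProj (T := Tr) (c := c) i x) = f (limitProj (T := Tr) (c := c) 0 x) := by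
    intro i x
    induction i with
    | zero => rfl
    | succ i ih =>
      rw [← ih, ← hproj i x]
      rfl
  have hclopen : ∀ i, IsClopenSet {x : (limit c).Branch | f (limitProj (T := Tr) (c := c) 0 x) ∈ A i} := by
    intro i
    have h := (hcov i (seq i)).preimage (f := limitProj (T := Tr) (c := c) (i + 1))
      fun x y n h => congrArg (fun v => v.1 (i + 1)) h
    convert h using 1
    ext x
    change _ ↔ (seq i).2.1 ((c i).branchMap (limitProj (T := Tr) (c := c) (i + 1) x)) ∈ A i
    rw [hproj, hf']
    rfl
  have hopen : IsOpenSet {x : (limit c).Branch | f (limitProj (T := Tr) (c := c) 0 x) ∈ ⋃ i, A i} := by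
    intro x hx
    obtain ⟨i, hi⟩ := Set.mem_iUnion.1 hx
    obtain ⟨n, hn⟩ := (hclopen i).1 x hi
    exact ⟨n, fun y hy => Set.mem_iUnion.2 ⟨i, hn y hy⟩⟩
  obtain ⟨T', d, hd⟩ := hopen.exists_cover N
  exact ⟨T', (limitCover c).comp d, hd⟩

/-- The index may also be a proof; this covers bounded quantifiers and tests defined only on `dom`.
-/
theorem exists_countable {ι : Sort*} [Countable ι] {p : ι → (ℕ → L) → Prop}
    (h : ∀ i, UniversallyUnravelled.{u} {α | p i α}) :
    UniversallyUnravelled.{u} {α | ∃ i, p i α} := by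
  rcases isEmpty_or_nonempty ι with hι | hι
  · simpa using const (L := L) False
  · obtain ⟨g, hg⟩ := exists_surjective_nat ι
    have e : {α | ∃ i, p i α} = ⋃ n, {α | p (g n) α} := by
      ext α
      simp [hg.exists]
    rw [e]
    exact iUnion_nat fun n => h (g n)

theorem forall_countable {ι : Sort*} [Countable ι] {p : ι → (ℕ → L) → Prop}
    (h : ∀ i, UniversallyUnravelled.{u} {α | p i α}) :
    UniversallyUnravelled.{u} {α | ∀ i, p i α} := by
  have e : {α | ∀ i, p i α} = {α | ∃ i, ¬ p i α}ᶜ := by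
    ext α
    simp
  rw [e]
  exact (exists_countable fun i => (h i).compl).compl

theorem or {p q : (ℕ → L) → Prop} (hp : UniversallyUnravelled.{u} {α | p α})
    (hq : UniversallyUnravelled.{u} {α | q α}) : UniversallyUnravelled.{u} {α | p α ∨ q α} := by
  have e : {α | p α ∨ q α} = {α | ∃ b : Bool, cond b (p α) (q α)} := by
    ext α
    simp [or_comm]
  rw [e]
  exact exists_countable fun b => by cases b <;> assumption

theorem and {p q : (ℕ → L) → Prop} (hp : UniversallyUnravelled.{u} {α | p α})
    (hq : UniversallyUnravelled.{u} {α | q α}) : UniversallyUnravelled.{u} {α | p α ∧ q α} := by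
  have e : {α | p α ∧ q α} = {α | ∀ b : Bool, cond b (p α) (q α)} := by
    ext α
    simp [and_comm]
  rw [e]
  exact forall_countable fun b => by cases b <;> assumption

end UniversallyUnravelled

theorem Branch.node_zero {T : GameTree.{u}} (x : T.Branch) : x.node 0 = T.root :=
  T.eq_root _ (x.level_node 0)

/-- Open games are determined. -/
theorem IsOpenSet.determined {T : GameTree.{u}} {B : Set T.Branch} (hB : IsOpenSet B) :
    (∃ s : T.Strategy, ∀ x, Follows 0 s x → x ∈ B) ∨
      ∃ s : T.Strategy, ∀ x, Follows 1 s x → x ∉ B := by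
  classical
  let R : Set T.Node := {v | ∀ x : T.Branch, x.node (T.level v) = v → x ∈ B}
  let C : Attractor T.IsChild (fun v => T.level v % 2 = 0) R := Classical.choice inferInstance
  let s₀ : T.Strategy := Classical.arbitrary _
  by_cases h : T.root ∈ C.carrier
  · left
    refine ⟨⟨fun v => if T.IsChild v (C.move v) then C.move v else s₀.next v, fun v => ?_⟩,
      fun x hx => ?_⟩
    · split_ifs with h
      exacts [h, s₀.isChild v]
    · obtain ⟨n, -, hn⟩ := C.reaches x.node 0 (by rwa [x.node_zero])
        (fun n _ h1 h2 h3 => (hx n (by rwa [x.level_node] at h3)).trans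
          (if_pos (C.move_spec _ h1 h2 h3).1))
        (fun n _ _ _ _ => x.isChild n)
      exact hn x (by rw [x.level_node])
  · right
    have hex : ∀ v, ∃ w, T.IsChild v w ∧
        (v ∉ C.carrier → T.level v % 2 = 1 → w ∉ C.carrier) := by
      intro v
      by_cases hv : v ∉ C.carrier ∧ T.level v % 2 = 1
      · obtain ⟨w, hw, hw'⟩ := C.opp_compl v hv.1 (by omega)
        exact ⟨w, hw, fun _ _ => hw'⟩
      · exact ⟨_, s₀.isChild v, fun h1 h2 => absurd ⟨h1, h2⟩ hv⟩
    choose g hg hg' using hex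
    refine ⟨⟨g, hg⟩, fun x hx hxB => ?_⟩
    have hnot : ∀ n, x.node n ∉ C.carrier := by
      intro n
      induction n with
      | zero => rwa [x.node_zero]
      | succ n ih =>
        rcases Nat.mod_two_eq_zero_or_one n with hn | hn
        · exact C.own_compl _ ih (by rwa [x.level_node]) _ (x.isChild n)
        · rw [hx n hn]
          exact hg' _ ih (by rwa [x.level_node])
    obtain ⟨n, hn⟩ := hB x hxB
    exact hnot n (C.subset fun y hy => hn y (by rwa [x.level_node] at hy))

/-- Games with a universally unravelled winning condition are determined. -/
theorem UniversallyUnravelled.determined {L : Type v} {A : Set (ℕ → L)}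
    (hA : UniversallyUnravelled.{u} A) {T : GameTree.{u}} {f : T.Branch → ℕ → L}
    (hf : Continuous f) :
    (∃ s : T.Strategy, ∀ x, Follows 0 s x → f x ∈ A) ∨
      ∃ s : T.Strategy, ∀ x, Follows 1 s x → f x ∉ A := by
  -- Only the lifting of branches is used, so any bound would do.
  obtain ⟨T', c, hc⟩ := hA T f hf 0
  refine hc.1.determined.imp ?_ ?_
  · rintro ⟨s, hs⟩
    refine ⟨c.strat 0 s, fun x hx => ?_⟩
    obtain ⟨y, hy, hyx⟩ := c.lift 0 s x hx
    have e : c.branchMap y = x := Branch.ext (funext hyx)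
    exact e ▸ hs y hy
  · rintro ⟨s, hs⟩
    refine ⟨c.strat 1 s, fun x hx => ?_⟩
    obtain ⟨y, hy, hyx⟩ := c.lift 1 s x hx
    have e : c.branchMap y = x := Branch.ext (funext hyx)
    exact e ▸ hs y hy

theorem Branch.node_eq_of_le {T : GameTree.{u}} {x y : T.Branch} {m n : ℕ} (hmn : m ≤ n)
    (h : x.node n = y.node n) : x.node m = y.node m := by
  rw [← x.trunc_node hmn, ← y.trunc_node hmn, h]

theorem exists_branch_interleave {T : GameTree.{u}} (a b : ℕ → T.Node) (h0 : a 0 = T.root)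
    (hab : ∀ n, T.IsChild (a n) (b n)) (hba : ∀ n, T.IsChild (b n) (a (n + 1))) :
    ∃ x : T.Branch, ∀ n, x.node (2 * n) = a n ∧ x.node (2 * n + 1) = b n := by
  let x : ℕ → T.Node := fun k => if k % 2 = 0 then a (k / 2) else b (k / 2)
  have hx : ∀ n, x (2 * n) = a n ∧ x (2 * n + 1) = b n := fun n => by
    constructor
    · simp only [x]
      rw [if_pos (by omega), show 2 * n / 2 = n by omega]
    · simp only [x]
      rw [if_neg (by omega), show (2 * n + 1) / 2 = n by omega]
  have hc : ∀ k, T.IsChild (x k) (x (k + 1)) := by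
    intro k
    rcases Nat.even_or_odd' k with ⟨n, rfl | rfl⟩
    · rw [(hx n).1, (hx n).2]
      exact hab n
    · rw [(hx n).2, show 2 * n + 1 + 1 = 2 * (n + 1) by omega, (hx (n + 1)).1]
      exact hba n
  refine ⟨⟨x, fun k => ?_, fun k => (hc k).2⟩, hx⟩
  induction k with
  | zero => rw [(hx 0).1, h0, T.level_root]
  | succ k ih => rw [(hc k).1, ih]

/-- The tree of all finite sequences in `V`, with the last entry first. -/
def listTree (V : Type u) [Nonempty V] : GameTree.{u} where
  Node := List V
  level := List.length
  parent := List.tail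
  root := []
  level_parent v := by simp
  level_root := rfl
  eq_root _ h := List.eq_nil_of_length_eq_zero h
  exists_child v := ⟨Classical.arbitrary V :: v, rfl, rfl⟩

end GameTree

/-! ### VLDL conditions -/

open GameTree

/-- The conditions expressible in visibly linear dynamic logic are universally unravelled. -/
theorem VLDL.universallyUnravelled_sat {P : Type v} {κ : Set P → ActionKind} (φ : VLDL κ) (k : ℕ) :
    UniversallyUnravelled.{u} {α | φ.Sat α k} := by
  have hmatch : ∀ {n m : ℕ} (𝔄 : VPA κ (Fin n) (Fin m)) (test : Fin n → ℕ → (ℕ → Set P) → Prop),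
      (∀ q j, UniversallyUnravelled.{u} {α | test q j α}) → ∀ k l,
      UniversallyUnravelled.{u} {α | (k, l) ∈ 𝔄.matches (fun q j => test q j α) α} := by
    intro n m 𝔄 test htest k l
    -- Only `ρ 0, …, ρ l` matter. Encoding them by functions on `Fin (l + 1)`, extended constantly,
    -- leaves countably many candidate runs.
    let ext : (Fin (l + 1) → Fin n × List (Fin m)) → ℕ → Fin n × List (Fin m) :=
      fun r j => r ⟨min j l, by omega⟩
    have e : {α | (k, l) ∈ 𝔄.matches (fun q j => test q j α) α} =
        {α | k ≤ l ∧ ∃ r : Fin (l + 1) → Fin n × List (Fin m),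
          ((ext r k).1 ∈ 𝔄.init ∧ (ext r k).2 = [] ∧ (ext r l).1 ∈ 𝔄.final) ∧
          (∀ j, ∀ _ : k ≤ j ∧ j < l, 𝔄.Edge (ext r j) (α j) (ext r (j + 1))) ∧
          ∀ j, ∀ _ : k ≤ j ∧ j ≤ l, test (ext r j).1 j α} := by
      ext α
      constructor
      · rintro ⟨hkl, ρ, h1, h2, h3, h4, h5⟩
        have hr : ∀ j, j ≤ l → ext (fun i => ρ i.1) j = ρ j := fun j hj =>
          congrArg ρ (min_eq_left hj)
        refine ⟨hkl, fun i => ρ i.1, ⟨?_, ?_, ?_⟩, fun j hj => ?_, fun j hj => ?_⟩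
        · rwa [hr k hkl]
        · rwa [hr k hkl]
        · rwa [hr l le_rfl]
        · rw [hr j (by omega), hr (j + 1) (by omega)]
          exact h4 j hj.1 hj.2
        · rw [hr j hj.2]
          exact h5 j hj.1 hj.2
      · rintro ⟨hkl, r, ⟨h1, h2, h3⟩, h4, h5⟩
        exact ⟨hkl, ext r, h1, h2, h3, fun j hj hj' => h4 j ⟨hj, hj'⟩,
          fun j hj hj' => h5 j ⟨hj, hj'⟩⟩
    rw [e]
    refine .and (.const _) (.exists_countable fun r => .and (.const _) (.and ?_ ?_))
    · exact .forall_countable fun j => .forall_countable fun _ =>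
        .coordinate (fun a => 𝔄.Edge (ext r j) a (ext r (j + 1))) j
    · exact .forall_countable fun j => .forall_countable fun _ => htest _ _
  induction φ generalizing k with
  | atom p => exact .coordinate (fun a => p ∈ a) k
  | neg φ ih => exact (ih k).compl
  | and φ ψ ih₁ ih₂ => exact (ih₁ k).and (ih₂ k)
  | or φ ψ ih₁ ih₂ => exact (ih₁ k).or (ih₂ k)
  | diamond 𝔄 dom t φ iht ih =>
    have hm := hmatch 𝔄 (fun q j α => ∀ h : q ∈ dom, (t ⟨q, h⟩).Sat α j)
      (fun q j => .forall_countable fun h => iht _ j) k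
    simp only [VLDL.Sat]
    exact .exists_countable fun l => .and (.const _) (.and (hm l) (ih l))
  | box 𝔄 dom t φ iht ih =>
    have hm := hmatch 𝔄 (fun q j α => ∀ h : q ∈ dom, (t ⟨q, h⟩).Sat α j)
      (fun q j => .forall_countable fun h => iht _ j) k
    simp only [VLDL.Sat, imp_iff_not_or]
    exact .forall_countable fun l => .or (.const _) (.or (hm l).compl (ih l))

/-! ### From arenas to trees -/

namespace VLDLGame

variable {P : Type v} {κ : Set P → ActionKind} {V : Type u} (G : VLDLGame κ V)

open Classical in
/-- The proposed successor `m` of `v`, corrected to an actual successor if necessary. -/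
noncomputable def legalMove (v m : V) : V :=
  if G.edge v m then m else if h : ∃ w, G.edge v w then h.choose else v

variable {G} in
theorem legalMove_of_edge {v m : V} (h : G.edge v m) : G.legalMove v m = m := if_pos h

theorem edge_legalMove {v : V} (h : ∃ w, G.edge v w) (m : V) : G.edge v (G.legalMove v m) := by
  unfold legalMove
  split_ifs with h'
  exacts [h', h.choose_spec]

/-- The play with the given history; its values beyond the history are irrelevant. -/
def ofHistory (w : List V) (v : V) (k : ℕ) : V := (w ++ [v]).getD k v

theorem ofHistory_map_range (π : ℕ → V) {n k : ℕ} (h : k ≤ n) :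
    ofHistory ((List.range n).map π) (π n) k = π k := by
  have e : (List.range n).map π ++ [π n] = (List.range (n + 1)).map π := by
    rw [List.range_succ, List.map_append]
    rfl
  rw [ofHistory, e, List.getD_eq_getElem _ _ (by simp; omega)]
  simp

section ListTree

variable [Nonempty V]

/-- The last entry of a finite sequence of vertices. -/
def lastMove (l : (listTree V).Node) : V := List.headD l G.start

/-- The play resulting from a sequence of proposals: in each vertex, first Player `0` and then
Player `1` proposes a successor, and the proposal of the owner is used. -/
noncomputable def playOf (x : (listTree V).Branch) : ℕ → V
  | 0 => G.start
  | n + 1 => G.legalMove (playOf x n) (G.lastMove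
      (if G.owner (playOf x n) = 0 then x.node (2 * n + 1) else x.node (2 * n + 2)))

/-- The first `n` moves of the play depend only on the first `2 * n` proposals. -/
theorem continuous_trace_playOf : Continuous fun x => G.trace (G.playOf x) := by
  have key : ∀ (x y : (listTree V).Branch) n, y.node (2 * n) = x.node (2 * n) →
      G.playOf y n = G.playOf x n := by
    intro x y n h
    induction n with
    | zero => rfl
    | succ n ih =>
      simp only [playOf]
      rw [ih (Branch.node_eq_of_le (by omega) h),
        Branch.node_eq_of_le (x := y) (y := x) (by omega) h,
        Branch.node_eq_of_le (x := y) (y := x) (m := 2 * n + 2) (by omega) h]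
  exact fun x n => ⟨2 * (n + 1), fun y hy => congrArg G.label (key x y (n + 1) hy)⟩

/-- The node reached after `n` moves of `π`, if Player `0` follows `s`. -/
def nodeZero (s : (listTree V).Strategy) (π : ℕ → V) : ℕ → (listTree V).Node
  | 0 => []
  | n + 1 => List.cons (π (n + 1)) (s.next (nodeZero s π n))

theorem nodeZero_congr (s : (listTree V).Strategy) {π π' : ℕ → V} {n : ℕ}
    (h : ∀ k ≤ n, π k = π' k) : nodeZero s π n = nodeZero s π' n := by
  induction n with
  | zero => rfl
  | succ n ih => rw [nodeZero, nodeZero, ih fun k hk => h k (by omega), h _ le_rfl]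

open Classical in
/-- The proposal of Player `0` in the `n`-th round of the play `π`, taken to be the current vertex
if it belongs to Player `1`. -/
noncomputable def proposalZero (π : ℕ → V) (n : ℕ) : V :=
  if G.owner (π n) = 0 then π (n + 1) else π n

/-- The node reached after `n` moves of `π`, if Player `1` follows `s`. -/
noncomputable def nodeOne (s : (listTree V).Strategy) (π : ℕ → V) : ℕ → (listTree V).Node
  | 0 => []
  | n + 1 => s.next (List.cons (G.proposalZero π n) (nodeOne s π n))

theorem nodeOne_congr (s : (listTree V).Strategy) {π π' : ℕ → V} {n : ℕ}
    (h : ∀ k ≤ n, π k = π' k) : G.nodeOne s π n = G.nodeOne s π' n := by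
  induction n with
  | zero => rfl
  | succ n ih =>
    rw [nodeOne, nodeOne, ih fun k hk => h k (by omega), proposalZero, proposalZero,
      h n (by omega), h _ le_rfl]

/-- The actual play is replayed in the tree, with Player `1` always proposing the vertex that came
next. This proposal is made after that of Player `0`, so the answer of `s` depends on the history
only. -/
theorem wins_zero (s : (listTree V).Strategy)
    (hs : ∀ x, Follows 0 s x → G.trace (G.playOf x) ∈ G.cond.language) : G.Wins 0 := by
  refine ⟨fun w v => G.legalMove v (G.lastMove (s.next (nodeZero s (ofHistory w v) w.length))),
    fun w v hv => G.edge_legalMove hv _, fun π hπ hc => ?_⟩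
  obtain ⟨x, hx⟩ := exists_branch_interleave (T := listTree V) (fun n => nodeZero s π n)
    (fun n => s.next (nodeZero s π n)) rfl (fun n => s.isChild _) (fun n => ⟨rfl, rfl⟩)
  have hplay : ∀ n, G.playOf x n = π n := by
    intro n
    induction n with
    | zero => exact hπ.1.symm
    | succ n ih =>
      rw [playOf, ih]
      by_cases ho : G.owner (π n) = 0
      · rw [if_pos ho, (hx n).2, ← hc n ho]
        simp only [List.length_map, List.length_range]
        rw [nodeZero_congr s fun k hk => ofHistory_map_range π hk]
      · rw [if_neg ho, show 2 * n + 2 = 2 * (n + 1) by omega, (hx (n + 1)).1]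
        exact legalMove_of_edge (hπ.2 n)
  have hf : Follows 0 s x := by
    intro k hk
    obtain ⟨n, rfl⟩ : ∃ n, k = 2 * n := ⟨k / 2, by change k % 2 = 0 at hk; omega⟩
    rw [(hx n).1, (hx n).2]
  have h := hs x hf
  rw [show G.playOf x = π from funext hplay] at h
  exact h

/-- Here `s` sees the proposal of Player `0` before answering. At a vertex of Player `1` the next
vertex is still to be determined by `s`, so the current vertex stands in for that proposal, which
`playOf` ignores there. -/
theorem wins_one (s : (listTree V).Strategy)
    (hs : ∀ x, Follows 1 s x → G.trace (G.playOf x) ∉ G.cond.language) : G.Wins 1 := by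
  refine ⟨fun w v => G.legalMove v (G.lastMove
      (s.next (List.cons v.1 (G.nodeOne s (ofHistory w v) w.length)))),
    fun w v hv => G.edge_legalMove hv _, fun π hπ hc => ?_⟩
  obtain ⟨x, hx⟩ := exists_branch_interleave (T := listTree V) (fun n => G.nodeOne s π n)
    (fun n => List.cons (G.proposalZero π n) (G.nodeOne s π n)) rfl (fun n => ⟨rfl, rfl⟩)
    (fun n => s.isChild _)
  have hplay : ∀ n, G.playOf x n = π n := by
    intro n
    induction n with
    | zero => exact hπ.1.symm
    | succ n ih =>
      rw [playOf, ih]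
      by_cases ho : G.owner (π n) = 0
      · rw [if_pos ho, (hx n).2, proposalZero, if_pos ho]
        exact legalMove_of_edge (hπ.2 n)
      · have ho' : G.owner (π n) = 1 := by omega
        rw [if_neg ho, show 2 * n + 2 = 2 * (n + 1) by omega, (hx (n + 1)).1, ← hc n ho']
        simp only [List.length_map, List.length_range, nodeOne]
        rw [nodeOne_congr G s fun k hk => ofHistory_map_range π hk, proposalZero, if_neg ho]
  have hf : Follows 1 s x := by
    intro k hk
    obtain ⟨n, rfl⟩ : ∃ n, k = 2 * n + 1 := ⟨k / 2, by change k % 2 = 1 at hk; omega⟩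
    rw [(hx n).2, show 2 * n + 1 + 1 = 2 * (n + 1) by omega, (hx (n + 1)).1]
    rfl
  have h := hs x hf
  rw [show G.playOf x = π from funext hplay] at h
  exact h

end ListTree

theorem determined : G.Determined := by
  have : Nonempty V := ⟨G.start⟩
  refine (G.cond.universallyUnravelled_sat 0).determined G.continuous_trace_playOf |>.imp ?_ ?_
  · rintro ⟨s, hs⟩
    exact G.wins_zero s hs
  · rintro ⟨s, hs⟩
    exact G.wins_one s hs

end VLDLGame

theorem mainTheorem10 {P Q Γ : Type*} [Finite P] [Finite Q] [Finite Γ]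
    (κ : Set P → ActionKind) (H : VPG κ Q Γ) (a₀ : Set P) :
    (H.toGame a₀).Determined :=
  (H.toGame a₀).determined
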